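/- Let $L$ and $N$ be positive integers, and for a positive integer $\beta$ let $$C_N=C_N(\beta)=\frac1{N!}\int_{[-\pi,\pi)^N}\prod_{m<n}\bigl|e^{i\theta_n}-e^{i\theta_m}\bigr|^{\beta}\,d\theta_1\cdots d\theta_N$$ be the partition function of Dyson's circular ensemble, and let $\mu=\mu_{N,\beta}$ be the complex measure on $[-\pi,\pi)$ $$d\mu(\theta)=(-ie^{-i\theta})^{\beta(N-1)/2}\,d\theta:=e^{-i(\theta+\pi/2)\beta(N-1)/2}\,d\theta .$$ Let $\mathbf p=(p_n)_{n=1}^{NL}$ be any family of monic polynomials in $\mathbb C[x]$ with $\deg p_n=n-1$. Let $V=\mathbb C^{NL}$ with standard basis $\mathbf e_1,\dots,\mathbf e_{NL}$; for an increasing map $\mathfrak t:\{1,\dots,L\}\to\{1,\dots,NL\}$ put $\epsilon_{\mathfrak t}=\mathbf e_{\mathfrak t(1)}\wedge\cdots\wedge\mathbf e_{\mathfrak t(L)}$ and $$\mathrm{Wr}(\mathbf p_{\mathfrak t};x)=\det\Bigl[\tfrac1{(\ell-1)!}\,p_{\mathfrak t(n)}^{(\ell-1)}(x)\Bigr]_{n,\ell=1}^{L},\qquad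 \omega(x)=\sum_{\mathfrak t}\mathrm{Wr}(\mathbf p_{\mathfrak t};x)\,\epsilon_{\mathfrak t}\in\Lambda^LV .$$ Let $V'=\mathbb C^{(N+1)L}\supset V$ and $\epsilon'=\mathbf e_{NL+1}\wedge\cdots\wedge\mathbf e_{NL+L}$. Forms are integrated coefficientwise. For a $d$-form $\alpha$ on $\mathbb C^{kd}$ the hyperpfaffian $\mathrm{PF}\,\alpha$ is defined by $\alpha^{\wedge k}/k!=\mathrm{PF}\,\alpha\cdot\mathbf e_1\wedge\cdots\wedge\mathbf e_{kd}$. Then: 1. if $\beta=L^2$ is even, $$C_N=\mathrm{PF}\Bigl(\int_{-\pi}^{\pi}\omega(e^{i\theta})\,d\mu(\theta)\Bigr);$$ 2. if $\beta=L^2$ is odd and $N$ is even, $$C_N=\mathrm{PF}\Bigl(\frac12\int_{-\pi}^{\pi}\!\int_{-\pi}^{\pi}\omega(e^{i\theta})\wedge\omega(e^{i\psi})\,\mathrm{sgn}(\psi-\theta)\,d\mu(\theta)\,d\mu(\psi)\Bigr);$$ 3. if $\beta=L^2$ is odd and $N$ is odd, then, with the hyperpfaffian taken on $V'$, $$C_N=\mathrm{PF}\Bigl(\frac12\int_{-\pi}^{\pi}\!\int_{-\pi}^{\pi}\omega(e^{i\theta})\wedge\omega(e^{i\psi})\,\mathrm{sgn}(\psi-\theta)\,d\mu(\theta)\,d\mu(\psi)+\int_{-\pi}^{\pi}\omega(e^{i\theta})\wedge\epsilon'\,d\mu(\theta)\Bigr);$$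 4. if $\beta=L^2+1$ is even and $N=2M$ is even, $$C_N=\mathrm{PF}\Bigl(\frac12\int_{-\pi}^{\pi}\!\int_{-\pi}^{\pi}\omega(e^{i\theta})\wedge\omega(e^{i\psi})\,\frac{(e^{iM\psi}-e^{iM\theta})^2}{e^{i\psi}-e^{i\theta}}\,d\mu(\theta)\,d\mu(\psi)\Bigr).$$ -/

import Mathlib

open scoped Polynomial

noncomputable section

/-- Dyson's circular partition function
`C_N = (1/N!) ∫_{[-π,π)^N} ∏_{m<n} |e^{iθ_n} - e^{iθ_m}|^β dθ_1 ⋯ dθ_N`. -/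
def circularPartition (N β : ℕ) : ℝ :=
  (1 / (N.factorial : ℝ)) *
    ∫ θ in Set.univ.pi (fun _ : Fin N => Set.Ico (-Real.pi) Real.pi),
      ∏ m : Fin N, ∏ n ∈ Finset.Ioi m,
        ‖Complex.exp (Complex.I * (θ n : ℂ)) - Complex.exp (Complex.I * (θ m : ℂ))‖ ^ β

/-- The density `(-i e^{-iθ})^{β(N-1)/2}`. Where the exponent is a half-integer, the power is the
branch that is continuous on `[-π,π)`, so that `-i e^{-iθ} = e^{-i(θ + π/2)}` is raised to a power
by multiplying its argument `-(θ + π/2)`. -/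
def circularDensity (N β : ℕ) (θ : ℝ) : ℂ :=
  Complex.exp (-Complex.I * ((θ : ℂ) + (Real.pi : ℂ) / 2) * ((β : ℂ) * ((N : ℂ) - 1) / 2))

/-- The square of the density is `(-i e^{-iθ})^{β(N-1)}`. -/
theorem circularDensity_sq (N β : ℕ) (hN : 0 < N) (θ : ℝ) :
    circularDensity N β θ ^ 2 =
      (-Complex.I * Complex.exp (-Complex.I * (θ : ℂ))) ^ (β * (N - 1)) := by
  have h : -Complex.I * Complex.exp (-Complex.I * (θ : ℂ)) =
      Complex.exp (-Complex.I * ((θ : ℂ) + (Real.pi : ℂ) / 2)) := by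
    have h2 : -Complex.I * ((θ : ℂ) + (Real.pi : ℂ) / 2) =
        -((Real.pi : ℂ) / 2 * Complex.I) + -Complex.I * (θ : ℂ) := by ring
    rw [h2, Complex.exp_add, Complex.exp_neg, Complex.exp_pi_div_two_mul_I, Complex.inv_I]
  rw [h, circularDensity, ← Complex.exp_nat_mul, ← Complex.exp_nat_mul]
  congr 1
  push_cast [Nat.cast_sub (Nat.one_le_of_lt hN)]
  ring

/-- The integral `∫_{-π}^{π} f(θ) dμ(θ)` against the complex measure
`dμ(θ) = (-i e^{-iθ})^{β(N-1)/2} dθ` on `[-π,π)`. -/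
def circularIntegral (N β : ℕ) (f : ℝ → ℂ) : ℂ :=
  ∫ θ in Set.Ico (-Real.pi) Real.pi, f θ * circularDensity N β θ

/-- `𝐞_{t(1)} ∧ ⋯ ∧ 𝐞_{t(L)}` in the exterior algebra of `ℂⁿ`. -/
def wedgeBasis {n L : ℕ} (t : Fin L → Fin n) : ExteriorAlgebra ℂ (Fin n → ℂ) :=
  ExteriorAlgebra.ιMulti ℂ L (fun l => (Pi.single (t l) 1 : Fin n → ℂ))

/-- The volume form `𝐞_1 ∧ ⋯ ∧ 𝐞_n`. -/
def volumeForm (n : ℕ) : ExteriorAlgebra ℂ (Fin n → ℂ) :=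
  wedgeBasis (fun i : Fin n => i)

/-- The coefficient of the volume form of `ℂⁿ` in an element of the exterior algebra. -/
def volumeCoeff (n : ℕ) : ExteriorAlgebra ℂ (Fin n → ℂ) →ₗ[ℂ] ℂ :=
  ExteriorAlgebra.liftAlternating (R := ℂ)
    (Pi.single n (Pi.basisFun ℂ (Fin n)).det :
      ∀ i, (Fin n → ℂ) [⋀^Fin i]→ₗ[ℂ] ℂ)

theorem volumeCoeff_ιMulti {n : ℕ} (v : Fin n → Fin n → ℂ) :
    volumeCoeff n (ExteriorAlgebra.ιMulti ℂ n v) = (Pi.basisFun ℂ (Fin n)).det v := by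
  rw [volumeCoeff, ExteriorAlgebra.liftAlternating_apply_ιMulti, Pi.single_eq_same]

theorem eq_volumeCoeff_smul {n : ℕ} (x : ExteriorAlgebra ℂ (Fin n → ℂ))
    (hx : x ∈ ⋀[ℂ]^n (Fin n → ℂ)) : x = volumeCoeff n x • volumeForm n := by
  rw [← ExteriorAlgebra.ιMulti_span_fixedDegree] at hx
  induction hx using Submodule.span_induction with
  | mem x hx =>
    obtain ⟨v, rfl⟩ := hx
    rw [volumeCoeff_ιMulti]
    have h : ExteriorAlgebra.ιMulti ℂ n =
        (LinearMap.toSpanSingleton ℂ _ (volumeForm n)).compAlternatingMap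
          (Pi.basisFun ℂ (Fin n)).det := by
      refine Module.Basis.ext_alternating (Pi.basisFun ℂ (Fin n)) fun v hv => ?_
      obtain ⟨σ, rfl⟩ : ∃ σ : Equiv.Perm (Fin n), v = σ :=
        ⟨Equiv.ofBijective v (Finite.injective_iff_bijective.1 hv), rfl⟩
      change ExteriorAlgebra.ιMulti ℂ n ((Pi.basisFun ℂ (Fin n)) ∘ σ) =
        (Pi.basisFun ℂ (Fin n)).det ((Pi.basisFun ℂ (Fin n)) ∘ σ) • volumeForm n
      rw [AlternatingMap.map_perm, AlternatingMap.map_perm, Module.Basis.det_self, volumeForm,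
        wedgeBasis, smul_assoc, one_smul]
      congr 2
      ext i
      simp
    exact congrArg (fun f => f v) h
  | zero => simp
  | add x y _ _ hx hy => rw [map_add, add_smul, ← hx, ← hy]
  | smul a x _ hx => rw [map_smul, smul_assoc, ← hx]

/-- The hyperpfaffian of a form `ω` on `ℂⁿ` of degree `n / k`: the coefficient of the volume form
in `ω^{∧k} / k!`. -/
def hyperpfaffian {n : ℕ} (k : ℕ) (ω : ExteriorAlgebra ℂ (Fin n → ℂ)) : ℂ :=
  volumeCoeff n ((1 / (k.factorial : ℂ)) • ω ^ k)

/-- The defining property of the hyperpfaffian. -/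
theorem hyperpfaffian_spec {n k d : ℕ} (hn : d * k = n) (ω : ExteriorAlgebra ℂ (Fin n → ℂ))
    (hω : ω ∈ ⋀[ℂ]^d (Fin n → ℂ)) :
    (1 / (k.factorial : ℂ)) • ω ^ k = hyperpfaffian k ω • volumeForm n := by
  refine eq_volumeCoeff_smul _ (Submodule.smul_mem _ _ ?_)
  have h := Submodule.pow_mem_pow _ hω k
  rw [← pow_mul, hn] at h
  exact h

/-- A complete family of monic polynomials: `p_i` is monic of degree `i`, indices starting at `0`. -/
def IsCompleteMonic {n : ℕ} (p : Fin n → ℂ[X]) : Prop :=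
  ∀ i, (p i).Monic ∧ (p i).natDegree = i

/-- The Wronskian `Wr(q; x) = det [D^ℓ q_n(x)]` with `D^ℓ = (1/ℓ!) d^ℓ/dx^ℓ`, `0 ≤ ℓ < L`. -/
def wronskian {L : ℕ} (q : Fin L → ℂ[X]) (x : ℂ) : ℂ :=
  (Matrix.of fun n l : Fin L =>
    (1 / ((l : ℕ).factorial : ℂ)) * (Polynomial.derivative^[(l : ℕ)] (q n)).eval x).det

/-- `Wr(𝐩_t; e^{iθ})`, the coefficient of `ω(e^{iθ})` at `ε_t`. -/
def wronskianAt {n L : ℕ} (p : Fin n → ℂ[X]) (t : Fin L ↪o Fin n) (θ : ℝ) : ℂ :=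
  wronskian (fun l => p (t l)) (Complex.exp (Complex.I * (θ : ℂ)))

/-- The form `∫ ω(e^{iθ}) dμ(θ)`, integrated coefficientwise. -/
def singleForm (N L β : ℕ) (p : Fin (N * L) → ℂ[X]) :
    ExteriorAlgebra ℂ (Fin (N * L) → ℂ) :=
  ∑ t : Fin L ↪o Fin (N * L), circularIntegral N β (wronskianAt p t) • wedgeBasis t

/-- The form `(1/2) ∫∫ ω(e^{iθ}) ∧ ω(e^{iψ}) κ(θ,ψ) dμ(θ) dμ(ψ)`, integrated coefficientwise. -/
def doubleForm (N L β : ℕ) (p : Fin (N * L) → ℂ[X]) (κ : ℝ → ℝ → ℂ) :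
    ExteriorAlgebra ℂ (Fin (N * L) → ℂ) :=
  ∑ t : Fin L ↪o Fin (N * L), ∑ u : Fin L ↪o Fin (N * L),
    ((1 / 2 : ℂ) * circularIntegral N β (fun ψ => circularIntegral N β (fun θ =>
      wronskianAt p t θ * wronskianAt p u ψ * κ θ ψ))) • (wedgeBasis t * wedgeBasis u)

/-- The inclusion `Λ(ℂ^{NL}) → Λ(ℂ^{(N+1)L})` that sends `𝐞_i` to `𝐞_i`. -/
def extendForm (N L : ℕ) :
    ExteriorAlgebra ℂ (Fin (N * L) → ℂ) →ₐ[ℂ] ExteriorAlgebra ℂ (Fin ((N + 1) * L) → ℂ) :=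
  ExteriorAlgebra.map ((Pi.basisFun ℂ (Fin (N * L))).constr ℂ (fun i =>
    (Pi.single (Fin.castLE (Nat.mul_le_mul_right L (Nat.le_succ N)) i) 1 :
      Fin ((N + 1) * L) → ℂ)))

/-- `ε' = 𝐞_{NL+1} ∧ ⋯ ∧ 𝐞_{NL+L}` in `Λ(ℂ^{(N+1)L})`. -/
def borderForm (N L : ℕ) : ExteriorAlgebra ℂ (Fin ((N + 1) * L) → ℂ) :=
  wedgeBasis (fun l : Fin L => Fin.cast (Nat.succ_mul N L).symm (Fin.natAdd (N * L) l))

/-- The kernel `sgn(ψ - θ)`. -/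
def signKernel (θ ψ : ℝ) : ℂ := (Real.sign (ψ - θ) : ℂ)

/-- The kernel `(e^{iMψ} - e^{iMθ})² / (e^{iψ} - e^{iθ})`, with value `0` at `e^{iψ} = e^{iθ}`
(which is also its continuous extension). -/
def powerKernel (M : ℕ) (θ ψ : ℝ) : ℂ :=
  (Complex.exp (Complex.I * (M : ℂ) * (ψ : ℂ)) - Complex.exp (Complex.I * (M : ℂ) * (θ : ℂ))) ^ 2 /
    (Complex.exp (Complex.I * (ψ : ℂ)) - Complex.exp (Complex.I * (θ : ℂ)))

end

/- The coefficients of `ω(x)` are the `L × L` minors of the Taylor coefficients of `p` at `x`, so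
`ω(x)` is the wedge product of `L` vectors, and `ω(x_1) ∧ ⋯ ∧ ω(x_N)` is the determinant of a
confluent Vandermonde matrix, `∏_{m<n} (x_n - x_m)^{L²}`, times the volume form. On the circle the
densities turn each difference `e^{iθ_n} - e^{iθ_m}` into the real number `2 sin((θ_n - θ_m)/2)`,
which up to sign is its absolute value. For even `L` this settles the first case. For odd `L` the
powers of a double integral with kernel `κ` integrate `∏_{m<n} (x_n - x_m)^{L²}` against a signed
sum over permutations, a multiple of the Pfaffian of `κ` (de Bruijn). That Pfaffian is
`∏_{m<n} sgn(θ_n - θ_m)` for the sign kernel, which makes the integrand nonnegative, and one more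
Vandermonde determinant for the power kernel; both evaluations amount to computing a power of a
2-form. For odd `N` the form `ε'` plays the role of the border of an odd Pfaffian. -/

noncomputable section

open MeasureTheory Finset
open scoped Nat

theorem add_pow_of_commute_of_mul_self {A : Type*} [Semiring A] {a b : A} (h : Commute a b)
    (hb : b * b = 0) (n : ℕ) : (a + b) ^ (n + 1) = a ^ (n + 1) + (n + 1) • (a ^ n * b) := by
  induction n with
  | zero => simp
  | succ n ih =>
    have hba : a ^ n * b * a = a ^ (n + 1) * b := by rw [mul_assoc, ← h.eq, ← mul_assoc, pow_succ]
    have hbb : a ^ n * b * b = 0 := by rw [mul_assoc, hb, mul_zero]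
    rw [pow_succ, ih, mul_add, add_mul, add_mul, smul_mul_assoc, smul_mul_assoc, hba, hbb,
      smul_zero, add_zero, ← pow_succ, add_assoc, succ_nsmul _ (n + 1)]

theorem sum_range_pow_of_commute_of_mul_self {A : Type*} [Semiring A] {b : ℕ → A}
    (hcomm : ∀ i j, Commute (b i) (b j)) (hsq : ∀ i, b i * b i = 0) (m : ℕ) :
    (∑ k ∈ range m, b k) ^ m = m ! • ((List.range m).map b).prod ∧
      (∑ k ∈ range m, b k) ^ (m + 1) = 0 := by
  induction m with
  | zero => simp
  | succ m ih =>
    have h : Commute (∑ k ∈ range m, b k) (b m) := Commute.sum_left _ _ _ fun k _ => hcomm k m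
    rw [sum_range_succ, add_pow_of_commute_of_mul_self h (hsq m),
      add_pow_of_commute_of_mul_self h (hsq m), pow_succ _ (m + 1), ih.2, ih.1]
    simp only [zero_mul, zero_add, smul_zero, and_true]
    rw [smul_mul_assoc, smul_smul, ← Nat.factorial_succ, List.prod_range_succ]

section ExteriorAlgebra

open ExteriorAlgebra

variable {R : Type*} [CommRing R] {M : Type*} [AddCommGroup M] [Module R M]

theorem ι_mul_ι_comm (x y : M) : ι R x * ι R y = -(ι R y * ι R x) :=
  eq_neg_of_add_eq_zero_left (ι_add_mul_swap x y)

theorem ιMulti_comp_cast {m n : ℕ} (h : m = n) (v : Fin n → M) :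
    ιMulti R m (v ∘ Fin.cast h) = ιMulti R n v := by
  subst h
  rfl

theorem ι_mul_ιMulti_comm (x : M) {n : ℕ} (v : Fin n → M) :
    ι R x * ιMulti R n v = (-1 : R) ^ n • (ιMulti R n v * ι R x) := by
  induction n with
  | zero => simp
  | succ n ih =>
    rw [ιMulti_succ_apply, ← mul_assoc, ι_mul_ι_comm x (v 0), neg_mul, mul_assoc, ih,
      mul_smul_comm, ← smul_neg, pow_succ, mul_smul, neg_smul, one_smul, mul_assoc]

theorem ιMulti_mul_ιMulti_comm {m n : ℕ} (v : Fin m → M) (w : Fin n → M) :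
    ιMulti R m v * ιMulti R n w = (-1 : R) ^ (m * n) • (ιMulti R n w * ιMulti R m v) := by
  induction m with
  | zero => simp
  | succ m ih =>
    rw [ιMulti_succ_apply, mul_assoc, ih, mul_smul_comm, ← mul_assoc, ι_mul_ιMulti_comm,
      smul_mul_assoc, smul_smul, ← pow_add, mul_assoc, Nat.succ_mul]

theorem exteriorPower_mul_comm {m n : ℕ} {x y : ExteriorAlgebra R M} (hx : x ∈ ⋀[R]^m M)
    (hy : y ∈ ⋀[R]^n M) : x * y = (-1 : R) ^ (m * n) • (y * x) := by
  rw [← ιMulti_span_fixedDegree] at hx hy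
  induction hx, hy using Submodule.span_induction₂ with
  | mem_mem x y hx hy =>
    obtain ⟨v, rfl⟩ := hx
    obtain ⟨w, rfl⟩ := hy
    exact ιMulti_mul_ιMulti_comm v w
  | zero_left => simp
  | zero_right => simp
  | add_left x y z _ _ _ h1 h2 => rw [add_mul, h1, h2, mul_add, smul_add]
  | add_right x y z _ _ _ h1 h2 => rw [mul_add, h1, h2, add_mul, smul_add]
  | smul_left r x y _ _ h => rw [smul_mul_assoc, h, mul_smul_comm, smul_comm]
  | smul_right r x y _ _ h => rw [mul_smul_comm, h, smul_mul_assoc, smul_comm]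

theorem commute_of_mem_exteriorPower_even {m n : ℕ} (hm : Even m) {x y : ExteriorAlgebra R M}
    (hx : x ∈ ⋀[R]^m M) (hy : y ∈ ⋀[R]^n M) : Commute x y := by
  rw [Commute, SemiconjBy, exteriorPower_mul_comm hx hy, (hm.mul_right n).neg_one_pow, one_smul]

theorem ιMulti_mul_self {n : ℕ} (hn : 0 < n) (v : Fin n → M) :
    ιMulti R n v * ιMulti R n v = 0 := by
  rw [ιMulti_mul_ιMulti]
  refine ιMulti_eq_zero_of_not_inj fun hinj => ?_
  have h : Fin.castAdd n ⟨0, hn⟩ = Fin.natAdd n ⟨0, hn⟩ :=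
    hinj (by rw [Fin.append_left, Fin.append_right])
  simp only [Fin.ext_iff, Fin.val_castAdd, Fin.val_natAdd] at h
  lia

theorem exteriorPower_eq_bot_of_finrank_lt [Nontrivial R] [Module.Free R M] [Module.Finite R M]
    {d : ℕ} (hd : Module.finrank R M < d) : ⋀[R]^d M = ⊥ := by
  rw [← Submodule.subsingleton_iff_eq_bot, ← Module.finrank_eq_zero_iff_of_free (R := R),
    exteriorPower.finrank_eq, Nat.choose_eq_zero_of_lt hd]

theorem map_mem_exteriorPower {M' : Type*} [AddCommGroup M'] [Module R M'] (f : M →ₗ[R] M')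
    {n : ℕ} {x : ExteriorAlgebra R M} (hx : x ∈ ⋀[R]^n M) :
    ExteriorAlgebra.map f x ∈ ⋀[R]^n M' := by
  have hle : (⋀[R]^n M).map (ExteriorAlgebra.map f).toLinearMap ≤ ⋀[R]^n M' := by
    rw [Submodule.map_pow, ι_range_map_map]
    exact pow_le_pow_left' LinearMap.map_le_range n
  exact hle (Submodule.mem_map_of_mem hx)

theorem ιMulti_eq_sum_det_smul {I : Type*} [Fintype I] [LinearOrder I] (b : Module.Basis I R M)
    {L : ℕ} (v : Fin L → M) :
    ιMulti R L v =
      ∑ t : Fin L ↪o I, (Matrix.of fun i j => b.coord (t j) (v i)).det • ιMulti R L (b ∘ t) := by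
  have h := congrArg Subtype.val ((b.exteriorPower L).sum_repr (exteriorPower.ιMulti R L v))
  rw [← Equiv.sum_comp Set.powersetCard.ofFinEmbEquiv] at h
  simpa [exteriorPower.basis_repr_apply, exteriorPower.ιMulti_family] using h.symm

theorem prod_ofFn_ιMulti {N L : ℕ} (v : Fin N → Fin L → M) :
    (List.ofFn fun j => ιMulti R L (v j)).prod =
      ιMulti R (N * L) (fun a => v a.divNat a.modNat) := by
  rw [ιMulti_apply, List.ofFn_mul, List.prod_flatten, List.map_ofFn]
  congr 2
  funext j
  rw [ιMulti_apply, Function.comp_apply]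
  congr 2
  funext l
  have hlt : (j : ℕ) * L + l < N * L := by
    calc (j : ℕ) * L + l < (j + 1) * L := by rw [add_mul, one_mul]; lia
      _ ≤ N * L := Nat.mul_le_mul_right _ j.2
  have hidx : (⟨(j : ℕ) * L + l, hlt⟩ : Fin (N * L)) = finProdFinEquiv (j, l) := by
    ext; simp [finProdFinEquiv, add_comm, mul_comm]
  have h := finProdFinEquiv.symm_apply_apply (j, l)
  rw [finProdFinEquiv_symm_apply, Prod.mk.injEq] at h
  rw [hidx, h.1, h.2]

theorem commute_ι_mul_ι (x y z : M) : Commute (ι R x * ι R y) (ι R z) := by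
  rw [Commute, SemiconjBy, mul_assoc, ι_mul_ι_comm y z, mul_neg, ← mul_assoc, ι_mul_ι_comm x z,
    neg_mul, neg_neg, mul_assoc]

theorem sum_ι_mul_ι_pow (x y : ℕ → M) (m : ℕ) :
    (∑ k ∈ range m, ι R (x k) * ι R (y k)) ^ m =
      m ! • ((List.range m).map fun k => ι R (x k) * ι R (y k)).prod := by
  refine (sum_range_pow_of_commute_of_mul_self (fun i j => ?_) (fun i => ?_) m).1
  · exact (commute_ι_mul_ι _ _ _).mul_right (commute_ι_mul_ι _ _ _)
  · rw [← mul_assoc, (commute_ι_mul_ι _ _ _).eq, ← mul_assoc, ι_sq_zero, zero_mul, zero_mul]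

theorem prod_map_ι_mul_ι_of_mem (v : ℕ → M) {i n : ℕ} (hi : i < n) :
    ((List.range n).map fun k => ι R (v k)).prod * ι R (v i) = 0 := by
  induction n with
  | zero => exact absurd hi (Nat.not_lt_zero i)
  | succ n ih =>
    rw [List.prod_range_succ, mul_assoc]
    rcases (Nat.lt_succ_iff_lt_or_eq.1 hi) with h | rfl
    · rw [ι_mul_ι_comm, mul_neg, ← mul_assoc, ih h, zero_mul, neg_zero]
    · rw [ι_sq_zero, mul_zero]

theorem prod_map_ι_mul_ι_sum (v : ℕ → M) (n : ℕ) :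
    ((List.range n).map fun k => ι R (v k)).prod * ι R (∑ i ∈ range n, v i) = 0 := by
  rw [map_sum, mul_sum]
  exact sum_eq_zero fun i hi => prod_map_ι_mul_ι_of_mem v (mem_range.1 hi)

theorem sum_range_sum_range_ι_mul_ι_two_mul (v : ℕ → M) (m : ℕ) :
    ∑ j ∈ range (2 * m), ∑ i ∈ range j, ι R (v i) * ι R (v j) =
      ∑ k ∈ range m, ι R (∑ i ∈ range (2 * k + 1), v i) * ι R (v (2 * k) + v (2 * k + 1)) := by
  induction m with
  | zero => simp
  | succ m ih =>
    rw [Nat.mul_succ, sum_range_succ, sum_range_succ, ih, sum_range_succ _ m, add_assoc]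
    simp only [← sum_mul, ← map_sum]
    congr 1
    rw [map_add, mul_add, sum_range_succ _ (2 * m), map_add, add_mul _ _ (ι R (v (2 * m))),
      ι_sq_zero, add_zero]

theorem prod_map_ι_sum_mul_ι_add (v : ℕ → M) (m : ℕ) :
    ((List.range m).map fun k =>
      ι R (∑ i ∈ range (2 * k + 1), v i) * ι R (v (2 * k) + v (2 * k + 1))).prod =
      ((List.range (2 * m)).map fun k => ι R (v k)).prod := by
  induction m with
  | zero => simp
  | succ m ih =>
    rw [Nat.mul_succ, List.prod_range_succ, ih, List.prod_range_succ, List.prod_range_succ,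
      ← mul_assoc, sum_range_succ, map_add, mul_add, prod_map_ι_mul_ι_sum, zero_add, map_add,
      mul_add, mul_assoc _ (ι R (v (2 * m))), ι_sq_zero, mul_zero, zero_add]

/- Grouping the terms of index `2k` and `2k + 1` turns the quadratic form into a sum of `n / 2`
commuting products of two vectors; in their product each factor `v 0 + ⋯ + v (2k)` only contributes
its last term. -/
theorem sum_ι_mul_ι_pow_mul_ι_sum_pow (v : ℕ → M) (n : ℕ) :
    (∑ j ∈ range n, ∑ i ∈ range j, ι R (v i) * ι R (v j)) ^ (n / 2) *
        ι R (∑ i ∈ range n, v i) ^ (n % 2) =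
      (n / 2)! • ((List.range n).map fun k => ι R (v k)).prod := by
  have heven (m : ℕ) : (∑ j ∈ range (2 * m), ∑ i ∈ range j, ι R (v i) * ι R (v j)) ^ m =
      m ! • ((List.range (2 * m)).map fun k => ι R (v k)).prod := by
    rw [sum_range_sum_range_ι_mul_ι_two_mul, sum_ι_mul_ι_pow, prod_map_ι_sum_mul_ι_add]
  obtain ⟨m, rfl | rfl⟩ := n.even_or_odd'
  · rw [Nat.mul_div_cancel_left m two_pos, Nat.mul_mod_right, pow_zero, mul_one, heven]
  · have hdiv : (2 * m + 1) / 2 = m := by lia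
    have hmod : (2 * m + 1) % 2 = 1 := by lia
    set Q := ∑ j ∈ range (2 * m), ∑ i ∈ range j, ι R (v i) * ι R (v j)
    set S := ι R (∑ i ∈ range (2 * m + 1), v i) with hS
    have hcomm : Commute Q S := Commute.sum_left _ _ _ fun j _ => Commute.sum_left _ _ _ fun i _ =>
      commute_ι_mul_ι _ _ _
    have hlast : ∑ i ∈ range (2 * m), ι R (v i) * ι R (v (2 * m)) = S * ι R (v (2 * m)) := by
      rw [← sum_mul, ← map_sum, hS, sum_range_succ, map_add, add_mul, ι_sq_zero, add_zero]
    have hsemi : SemiconjBy S Q (Q + S * ι R (v (2 * m))) := by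
      rw [SemiconjBy, add_mul, ← hcomm.eq, mul_assoc, ι_mul_ι_comm, mul_neg, ← mul_assoc,
        ι_sq_zero, zero_mul, neg_zero, add_zero]
    rw [hdiv, hmod, pow_one, sum_range_succ, hlast, ← (hsemi.pow_right m).eq,
      ← (hcomm.pow_left m).eq, heven, smul_mul_assoc, hS, sum_range_succ, map_add, mul_add,
      prod_map_ι_mul_ι_sum, zero_add, List.prod_range_succ]

theorem prod_map_ι_mul_ι (x y : ℕ → M) (m : ℕ) :
    ((List.range m).map fun k => ι R (x k) * ι R (y k)).prod =
      ((List.range m).reverse.map fun k => ι R (x k)).prod *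
        ((List.range m).map fun k => ι R (y k)).prod := by
  have hcomm (z : M) (m : ℕ) :
      Commute ((List.range m).map fun k => ι R (x k) * ι R (y k)).prod (ι R z) :=
    Commute.list_prod_left _ _ (by simp [commute_ι_mul_ι])
  induction m with
  | zero => simp
  | succ m ih =>
    rw [List.prod_range_succ, ← mul_assoc, (hcomm _ m).eq, ih, List.prod_range_succ,
      List.range_succ, List.reverse_append]
    simp [mul_assoc]

theorem sum_ι_mul_ι_nested_pow (v : ℕ → M) (m : ℕ) :
    (∑ k ∈ range m, ι R (v (m - 1 - k)) * ι R (v (m + k))) ^ m =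
      m ! • ((List.range (2 * m)).map fun k => ι R (v k)).prod := by
  have hreverse : (List.range m).reverse.map (fun k => ι R (v (m - 1 - k))) =
      (List.range m).map fun k => ι R (v k) := by
    refine List.ext_getElem (by simp) fun i hi _ => ?_
    simp only [List.length_map, List.length_reverse, List.length_range] at hi
    simp only [List.getElem_map, List.getElem_reverse, List.length_range, List.getElem_range]
    congr 2
    lia
  rw [sum_ι_mul_ι_pow, prod_map_ι_mul_ι, hreverse, two_mul, List.range_add, List.map_append,
    List.prod_append, List.map_map]
  rfl

end ExteriorAlgebra

section PairProd

/-- The product `c (τ 0) (τ 1) * c (τ 2) (τ 3) * ⋯` over consecutive pairs of indices that occurs in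
the expansion of Pfaffians; an unpaired last index `t` contributes the factor `s t`. -/
def pairProd {R T : Type*} [Mul R] [One R] (c : T → T → R) (s : T → R) :
    (n : ℕ) → (Fin n → T) → R
  | 0, _ => 1
  | 1, τ => s (τ 0)
  | n + 2, τ => c (τ 0) (τ 1) * pairProd c s n (fun i => τ i.succ.succ)

theorem pairProd_comp {R T T' : Type*} [Mul R] [One R] (c : T → T → R) (s : T → R) (f : T' → T) :
    ∀ (n : ℕ) (τ : Fin n → T'), pairProd c s n (fun i => f (τ i)) =
      pairProd (fun i j => c (f i) (f j)) (fun i => s (f i)) n τ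
  | 0, _ => rfl
  | 1, _ => rfl
  | n + 2, τ => congrArg (c (f (τ 0)) (f (τ 1)) * ·)
      (pairProd_comp c s f n (fun i => τ i.succ.succ))

theorem sum_fin_succ_fun {T M : Type*} [Fintype T] [AddCommMonoid M] {n : ℕ}
    (g : (Fin (n + 1) → T) → M) :
    ∑ τ, g τ = ∑ t, ∑ τ : Fin n → T, g (Fin.cons t τ) := by
  rw [← (Fin.consEquiv (fun _ : Fin (n + 1) => T)).sum_comp, Fintype.sum_prod_type]
  rfl

variable {R A T : Type*} [CommSemiring R] [Semiring A] [Algebra R A] [Fintype T]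

theorem sum_smul_mul_pow_mul_sum_smul_pow (c : T → T → R) (s : T → R) (e : T → A) :
    ∀ n : ℕ, (∑ t, ∑ u, c t u • (e t * e u)) ^ (n / 2) * (∑ t, s t • e t) ^ (n % 2) =
      ∑ τ : Fin n → T, pairProd c s n τ • (List.ofFn fun i => e (τ i)).prod
  | 0 => by simp [pairProd]
  | 1 => by
    rw [sum_fin_succ_fun]
    simp [pairProd]
  | n + 2 => by
    rw [Nat.add_div_right n two_pos, Nat.add_mod_right, pow_succ', mul_assoc,
      sum_smul_mul_pow_mul_sum_smul_pow c s e n, sum_fin_succ_fun, sum_mul]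
    refine sum_congr rfl fun t _ => ?_
    rw [sum_fin_succ_fun, sum_mul]
    refine sum_congr rfl fun u _ => ?_
    rw [mul_sum]
    refine sum_congr rfl fun τ _ => ?_
    simp only [pairProd, List.ofFn_succ, List.prod_cons, Fin.cons_succ, Fin.cons_zero,
      smul_mul_smul_comm, mul_assoc]
    rfl

end PairProd

section Pfaffian

open ExteriorAlgebra Equiv

/-- The signed sum over all permutations of the consecutive pair products of `c`. It equals
`(n / 2)!` times the Pfaffian of the alternating matrix `c - cᵀ`, bordered by `s` if `n` is odd. -/
def pfaffianSum {R : Type*} [CommRing R] {n : ℕ} (c : Fin n → Fin n → R) (s : Fin n → R) : R :=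
  ∑ σ : Perm (Fin n), ((Perm.sign σ : ℤ) : R) * pairProd c s n σ

theorem pfaffianSum_comp_perm {R : Type*} [CommRing R] {n : ℕ} (c : Fin n → Fin n → R)
    (s : Fin n → R) (ρ : Perm (Fin n)) :
    pfaffianSum (fun i j => c (ρ i) (ρ j)) (fun i => s (ρ i)) =
      ((Perm.sign ρ : ℤ) : R) * pfaffianSum c s := by
  rw [pfaffianSum, pfaffianSum, ← Equiv.sum_comp (Equiv.mulLeft ρ) fun σ =>
    ((Perm.sign σ : ℤ) : R) * pairProd c s n σ, mul_sum]
  refine sum_congr rfl fun σ _ => ?_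
  have hsign : ((Perm.sign ρ : ℤ) : R) * ((Perm.sign ρ : ℤ) : R) = 1 := by
    rw [← Int.cast_mul, Int.units_coe_mul_self, Int.cast_one]
  rw [← pairProd_comp c s ρ, Equiv.coe_mulLeft, Perm.sign_mul, Units.val_mul, Int.cast_mul,
    ← mul_assoc, ← mul_assoc, hsign, one_mul]
  rfl

variable {R : Type*} [CommRing R] {M : Type*} [AddCommGroup M] [Module R M]

theorem sum_smul_ιMulti_comp {n : ℕ} (g : (Fin n → Fin n) → R) (v : Fin n → M) :
    ∑ τ : Fin n → Fin n, g τ • ιMulti R n (fun i => v (τ i)) =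
      (∑ σ : Perm (Fin n), ((Perm.sign σ : ℤ) : R) * g σ) • ιMulti R n v := by
  rw [sum_smul]
  symm
  refine Fintype.sum_of_injective (fun σ : Perm (Fin n) => (σ : Fin n → Fin n))
    DFunLike.coe_injective _ _ (fun τ hτ => ?_) (fun σ => ?_)
  · have hτ' : ¬ Function.Injective τ := fun h =>
      hτ ⟨Equiv.ofBijective τ (Finite.injective_iff_bijective.1 h), rfl⟩
    rw [ιMulti_eq_zero_of_not_inj fun h => hτ' fun i j hij => h (congrArg v hij), smul_zero]
  · have hperm := (ιMulti R n).map_perm v σ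
    rw [show (fun i => v (σ i)) = v ∘ σ from rfl, hperm, mul_comm, mul_smul, Units.smul_def,
      Int.cast_smul_eq_zsmul]

theorem sum_smul_ι_mul_ι_pow_mul_sum_smul_ι_pow {n : ℕ} (c : Fin n → Fin n → R) (s : Fin n → R)
    (v : Fin n → M) :
    (∑ i, ∑ j, c i j • (ι R (v i) * ι R (v j))) ^ (n / 2) * (∑ i, s i • ι R (v i)) ^ (n % 2) =
      pfaffianSum c s • ιMulti R n v := by
  rw [sum_smul_mul_pow_mul_sum_smul_pow, pfaffianSum, ← sum_smul_ιMulti_comp]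
  simp only [ιMulti_apply]

theorem volumeCoeff_volumeForm (n : ℕ) : volumeCoeff n (volumeForm n) = 1 := by
  have hbasis : (fun i => Pi.single i 1) = ⇑(Pi.basisFun ℂ (Fin n)) :=
    funext fun i => (Pi.basisFun_apply ℂ (Fin n) i).symm
  rw [volumeForm, wedgeBasis, volumeCoeff_ιMulti, hbasis, Module.Basis.det_self]

theorem pfaffianSum_eq_of_sum_pow_mul_sum_pow {n : ℕ} {c : Fin n → Fin n → ℂ} {s : Fin n → ℂ}
    {r : ℂ} (h : ∀ v : Fin n → Fin n → ℂ,
      (∑ i, ∑ j, c i j • (ι ℂ (v i) * ι ℂ (v j))) ^ (n / 2) *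
        (∑ i, s i • ι ℂ (v i)) ^ (n % 2) = r • ιMulti ℂ n v) :
    pfaffianSum c s = r := by
  have hform := (sum_smul_ι_mul_ι_pow_mul_sum_smul_ι_pow c s _).symm.trans
    (h fun i => Pi.single i 1)
  rw [← wedgeBasis, ← volumeForm] at hform
  simpa only [map_smul, smul_eq_mul, volumeCoeff_volumeForm, mul_one] using
    congrArg (volumeCoeff n) hform

end Pfaffian

section PfaffianEvaluation

open ExteriorAlgebra Equiv

variable {R : Type*} [CommRing R] {M : Type*} [AddCommGroup M] [Module R M]

theorem prod_map_ι_range (v : ℕ → M) (n : ℕ) :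
    ((List.range n).map fun k => ι R (v k)).prod = ιMulti R n (fun i => v i) := by
  rw [ιMulti_apply, List.ofFn_eq_map, ← List.map_coe_finRange_eq_range, List.map_map]
  rfl

theorem ιMulti_sum_smul {n : ℕ} (B : Matrix (Fin n) (Fin n) R) (v : Fin n → M) :
    ιMulti R n (fun k => ∑ i, B i k • v i) = B.det • ιMulti R n v := by
  rw [Matrix.det_apply', ← sum_smul_ιMulti_comp (fun τ => ∏ k, B (τ k) k),
    ← AlternatingMap.coe_multilinearMap, MultilinearMap.map_sum]
  exact sum_congr rfl fun τ _ => MultilinearMap.map_smul_univ _ _ _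

theorem sum_sub_smul_ι_mul_ι {T : Type*} [Fintype T] (a b : T → R) (v : T → M) :
    ∑ i, ∑ j, (a i * b j - b i * a j) • (ι R (v i) * ι R (v j)) =
      (2 : R) • (ι R (∑ i, a i • v i) * ι R (∑ i, b i • v i)) := by
  have hprod (a b : T → R) : ∑ i, ∑ j, (a i * b j) • (ι R (v i) * ι R (v j)) =
      ι R (∑ i, a i • v i) * ι R (∑ i, b i • v i) := by
    simp only [map_sum, map_smul, sum_mul_sum, smul_mul_smul_comm]
  simp only [sub_smul, sum_sub_distrib, hprod]
  rw [ι_mul_ι_comm (∑ i, b i • v i), sub_neg_eq_add, two_smul]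

theorem sum_range_sum_range_of_symm {A : Type*} [AddCommMonoid A] {f : ℕ → ℕ → A}
    (hsymm : ∀ i j, f i j = f j i) (hdiag : ∀ i, f i i = 0) (n : ℕ) :
    ∑ i ∈ range n, ∑ j ∈ range n, f i j = 2 • ∑ j ∈ range n, ∑ i ∈ range j, f i j := by
  induction n with
  | zero => simp
  | succ n ih =>
    simp only [sum_range_succ, sum_add_distrib, ih, hdiag, add_zero, nsmul_add, hsymm n]
    rw [add_assoc, two_nsmul (∑ i ∈ range n, f i n)]

theorem signKernel_swap (θ ψ : ℝ) : signKernel θ ψ = -signKernel ψ θ := by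
  rw [signKernel, signKernel, ← neg_sub θ ψ, Real.sign_neg, Complex.ofReal_neg]

theorem signKernel_of_lt {θ ψ : ℝ} (h : θ < ψ) : signKernel θ ψ = 1 := by
  rw [signKernel, Real.sign_of_pos (sub_pos.2 h), Complex.ofReal_one]

theorem signKernel_self (θ : ℝ) : signKernel θ θ = 0 := by
  rw [signKernel, sub_self, Real.sign_zero, Complex.ofReal_zero]

theorem signKernel_of_strictMono {n : ℕ} {θ : Fin n → ℝ} (hθ : StrictMono θ) (i j : Fin n) :
    signKernel (θ i) (θ j) = signKernel (i : ℕ) (j : ℕ) := by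
  rcases lt_trichotomy i j with h | rfl | h
  · rw [signKernel_of_lt (hθ h), signKernel_of_lt (Nat.cast_lt.2 h)]
  · rw [signKernel_self, signKernel_self]
  · rw [signKernel_swap, signKernel_of_lt (hθ h), signKernel_swap,
      signKernel_of_lt (Nat.cast_lt.2 h)]

theorem pfaffianSum_signKernel_natCast (n : ℕ) :
    pfaffianSum (fun i j : Fin n => (1 / 2 : ℂ) * signKernel (i : ℕ) (j : ℕ)) (fun _ => 1) =
      ((n / 2)! : ℂ) := by
  refine pfaffianSum_eq_of_sum_pow_mul_sum_pow fun v => ?_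
  obtain ⟨w, rfl⟩ : ∃ w : ℕ → Fin n → ℂ, v = fun i : Fin n => w i :=
    ⟨fun k => if h : k < n then v ⟨k, h⟩ else 0, by simp⟩
  let f (i j : ℕ) := ((1 / 2 : ℂ) * signKernel i j) • (ι ℂ (w i) * ι ℂ (w j))
  have hsymm (i j : ℕ) : f i j = f j i := by
    simp only [f]
    rw [signKernel_swap, ι_mul_ι_comm, mul_neg, neg_smul_neg]
  have hdiag (i : ℕ) : f i i = 0 := by simp only [f, ι_sq_zero, smul_zero]
  have hquad : ∑ i : Fin n, ∑ j : Fin n,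
      ((1 / 2 : ℂ) * signKernel (i : ℕ) (j : ℕ)) • (ι ℂ (w i) * ι ℂ (w j)) =
      ∑ j ∈ range n, ∑ i ∈ range j, ι ℂ (w i) * ι ℂ (w j) := by
    calc _ = ∑ i ∈ range n, ∑ j ∈ range n, f i j := by simp only [sum_range, f]
      _ = 2 • ∑ j ∈ range n, ∑ i ∈ range j, f i j := sum_range_sum_range_of_symm hsymm hdiag n
      _ = _ := by
        simp only [smul_sum]
        refine sum_congr rfl fun j _ => sum_congr rfl fun i hi => ?_
        simp only [f]
        rw [signKernel_of_lt (Nat.cast_lt.2 (mem_range.1 hi)), ← Nat.cast_smul_eq_nsmul ℂ,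
          smul_smul]
        norm_num
  simp only [hquad, one_smul, ← map_sum]
  rw [← sum_range, sum_ι_mul_ι_pow_mul_ι_sum_pow, prod_map_ι_range, Nat.cast_smul_eq_nsmul]

theorem pfaffianSum_signKernel_of_injective {n : ℕ} {θ : Fin n → ℝ}
    (hθ : Function.Injective θ) :
    pfaffianSum (fun i j => (1 / 2 : ℂ) * signKernel (θ i) (θ j)) (fun _ => 1) =
      ((n / 2)! : ℂ) * ∏ i, ∏ j ∈ Ioi i, signKernel (θ i) (θ j) := by
  set ρ := Tuple.sort θ
  have hmono : StrictMono (θ ∘ ρ) :=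
    (Tuple.monotone_sort θ).strictMono_of_injective (hθ.comp ρ.injective)
  have hsum := pfaffianSum_comp_perm
    (fun i j => (1 / 2 : ℂ) * signKernel (θ i) (θ j)) (fun _ => 1) ρ
  have hprod := ρ.prod_Ioi_comp_eq_sign_mul_prod (f := fun i j => signKernel (θ i) (θ j))
    fun _ _ => signKernel_swap _ _
  have hsort : ∏ i, ∏ j ∈ Ioi i, signKernel (θ (ρ i)) (θ (ρ j)) = 1 :=
    prod_eq_one fun i _ => prod_eq_one fun j hj => signKernel_of_lt (hmono (mem_Ioi.1 hj))
  have hkernel (i j : Fin n) := signKernel_of_strictMono hmono i j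
  simp only [Function.comp_apply] at hkernel
  simp only [hkernel, pfaffianSum_signKernel_natCast] at hsum
  have hsign : ((Perm.sign ρ : ℤ) : ℂ) * ((Perm.sign ρ : ℤ) : ℂ) = 1 := by
    rw [← Int.cast_mul, Int.units_coe_mul_self, Int.cast_one]
  rw [hsort] at hprod
  linear_combination (((n / 2)! : ℂ) * ∏ i, ∏ j ∈ Ioi i, signKernel (θ i) (θ j) -
      pfaffianSum (fun i j => (1 / 2 : ℂ) * signKernel (θ i) (θ j)) fun _ => 1) * hsign -
    ((Perm.sign ρ : ℤ) : ℂ) * hsum + ((Perm.sign ρ : ℤ) : ℂ) * ((n / 2)! : ℂ) * hprod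

theorem pfaffianSum_signKernel {n : ℕ} (θ : Fin n → ℝ) :
    pfaffianSum (fun i j => (1 / 2 : ℂ) * signKernel (θ i) (θ j)) (fun _ => 1) =
      ((n / 2)! : ℂ) * ∏ i, ∏ j ∈ Ioi i, signKernel (θ i) (θ j) := by
  by_cases hθ : Function.Injective θ
  · exact pfaffianSum_signKernel_of_injective hθ
  obtain ⟨a, b, hab, hne⟩ : ∃ a b, θ a = θ b ∧ a < b := by
    obtain ⟨a, b, hab, hne⟩ := Function.not_injective_iff.1 hθ
    rcases hne.lt_or_gt with h | h
    exacts [⟨a, b, hab, h⟩, ⟨b, a, hab.symm, h⟩]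
  have hswap (i : Fin n) : θ (swap a b i) = θ i := by
    rw [apply_swap_eq_self hab]
  have hsum := pfaffianSum_comp_perm
    (fun i j => (1 / 2 : ℂ) * signKernel (θ i) (θ j)) (fun _ => 1) (swap a b)
  simp only [hswap, Perm.sign_swap hne.ne, Units.val_neg, Units.val_one, Int.cast_neg,
    Int.cast_one, neg_one_mul, self_eq_neg] at hsum
  have hprod : ∏ i, ∏ j ∈ Ioi i, signKernel (θ i) (θ j) = 0 :=
    prod_eq_zero (mem_univ a) (prod_eq_zero (mem_Ioi.2 hne) (hab ▸ signKernel_self _))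
  rw [hsum, hprod, mul_zero]

theorem pfaffianSum_sum_pow_sub (m : ℕ) (x : Fin (2 * m) → ℂ) :
    pfaffianSum (fun i j => (1 / 2 : ℂ) * ∑ k ∈ range m,
        (x i ^ (m - 1 - k) * x j ^ (m + k) - x i ^ (m + k) * x j ^ (m - 1 - k))) (fun _ => 1) =
      (m ! : ℂ) * (Matrix.vandermonde x).det := by
  refine pfaffianSum_eq_of_sum_pow_mul_sum_pow fun v => ?_
  have hquad : ∑ i, ∑ j, ((1 / 2 : ℂ) * ∑ k ∈ range m,
        (x i ^ (m - 1 - k) * x j ^ (m + k) - x i ^ (m + k) * x j ^ (m - 1 - k))) •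
        (ι ℂ (v i) * ι ℂ (v j)) =
      ∑ k ∈ range m,
        ι ℂ (∑ i, x i ^ (m - 1 - k) • v i) * ι ℂ (∑ i, x i ^ (m + k) • v i) := by
    simp only [mul_smul, sum_smul, ← smul_sum]
    rw [sum_comm_cycle]
    simp only [sum_sub_smul_ι_mul_ι, ← smul_sum, smul_smul]
    rw [div_mul_cancel₀ (1 : ℂ) two_ne_zero, one_smul]
  rw [hquad, Nat.mul_mod_right, pow_zero, mul_one, Nat.mul_div_cancel_left m two_pos,
    sum_ι_mul_ι_nested_pow (fun k => ∑ i, x i ^ k • v i), prod_map_ι_range, mul_smul,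
    ← ιMulti_sum_smul, Nat.cast_smul_eq_nsmul]
  rfl

theorem sum_pow_mul_pow_sub_mul_sub {R : Type*} [CommRing R] (x y : R) (m : ℕ) :
    (∑ k ∈ range m, (x ^ (m - 1 - k) * y ^ (m + k) - x ^ (m + k) * y ^ (m - 1 - k))) * (y - x) =
      (y ^ m - x ^ m) ^ 2 := by
  have hleft : ∑ k ∈ range m, x ^ (m - 1 - k) * y ^ (m + k) =
      y ^ m * ∑ k ∈ range m, y ^ k * x ^ (m - 1 - k) := by
    rw [mul_sum]
    exact sum_congr rfl fun k _ => by ring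
  have hright : ∑ k ∈ range m, x ^ (m + k) * y ^ (m - 1 - k) =
      x ^ m * ∑ k ∈ range m, y ^ k * x ^ (m - 1 - k) := by
    rw [mul_sum, ← sum_range_reflect]
    refine sum_congr rfl fun k hk => ?_
    rw [Nat.sub_sub_self (Nat.le_sub_one_of_lt (mem_range.1 hk))]
    ring
  rw [sum_sub_distrib, hleft, hright]
  linear_combination (y ^ m - x ^ m) * geom_sum₂_mul y x m

end PfaffianEvaluation

section ConfluentVandermonde

open Polynomial

variable {R : Type*} [CommRing R]

theorem det_linearMap_of_monic {n : ℕ} {p : Fin n → R[X]} (hdeg : ∀ i, (p i).natDegree = i)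
    (hmonic : ∀ i, (p i).Monic) (f : Fin n → R[X] →ₗ[R] R) :
    (Matrix.of fun i j => f j (p i)).det =
      (Matrix.of fun i j : Fin n => f j (X ^ (i : ℕ))).det := by
  have hexpand (i : Fin n) : p i = ∑ k : Fin n, (p i).coeff k • X ^ (k : ℕ) := by
    conv_lhs => rw [(p i).as_sum_range' n (by rw [hdeg]; exact i.2), sum_range]
    simp only [smul_X_eq_monomial]
  have hmul : (Matrix.of fun i j => f j (p i)) =
      (Matrix.of fun i j : Fin n => (p j).coeff i).transpose *
        Matrix.of fun i j : Fin n => f j (X ^ (i : ℕ)) := by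
    ext i j
    rw [Matrix.of_apply, hexpand i, map_sum]
    simp only [map_smul, smul_eq_mul]
    rfl
  rw [hmul, Matrix.det_mul, Matrix.det_transpose, Matrix.det_matrixOfPolynomials p hdeg hmonic,
    one_mul]

/-- The confluent Vandermonde matrix of the polynomials `p` at the nodes `x`, each of multiplicity
`L`: the column of index `j * L + l` holds the `l`-th Taylor coefficients at `x j`. -/
def confluentVandermonde {N L : ℕ} (x : Fin N → R) (p : Fin (N * L) → R[X]) :
    Matrix (Fin (N * L)) (Fin (N * L)) R :=
  Matrix.of fun a b => (taylor (x b.divNat) (p a)).coeff b.modNat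

/-- The Newton basis for Hermite interpolation at the nodes `x`, each of multiplicity `L`; it makes
the confluent Vandermonde matrix triangular. -/
def hermiteNewton {N : ℕ} (L : ℕ) (x : Fin N → R) (a : Fin (N * L)) : R[X] :=
  (∏ i ∈ Iio a.divNat, (X - C (x i)) ^ L) * (X - C (x a.divNat)) ^ (a.modNat : ℕ)

variable {N L : ℕ} (x : Fin N → R)

theorem hermiteNewton_monic (a : Fin (N * L)) : (hermiteNewton L x a).Monic :=
  (monic_prod_of_monic _ _ fun _ _ => (monic_X_sub_C _).pow _).mul ((monic_X_sub_C _).pow _)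

theorem natDegree_hermiteNewton [Nontrivial R] (a : Fin (N * L)) :
    (hermiteNewton L x a).natDegree = a := by
  rw [hermiteNewton, (monic_prod_of_monic _ _ fun _ _ => (monic_X_sub_C _).pow _).natDegree_mul
      ((monic_X_sub_C _).pow _),
    natDegree_prod_of_monic _ _ fun i _ => (monic_X_sub_C (x i)).pow L]
  simp only [(monic_X_sub_C _).natDegree_pow, natDegree_X_sub_C, mul_one, sum_const, Fin.card_Iio,
    smul_eq_mul, Fin.coe_divNat, Fin.coe_modNat]
  exact Nat.div_add_mod' _ _

theorem taylor_X_sub_C_self (r : R) : taylor r (X - C r) = X := by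
  rw [map_sub, taylor_X, taylor_C, add_sub_cancel_right]

theorem taylor_hermiteNewton_coeff_self (a : Fin (N * L)) :
    (taylor (x a.divNat) (hermiteNewton L x a)).coeff a.modNat =
      ∏ i ∈ Iio a.divNat, (x a.divNat - x i) ^ L := by
  rw [hermiteNewton, taylor_mul, taylor_pow, taylor_X_sub_C_self, coeff_mul_X_pow', if_pos le_rfl,
    Nat.sub_self, taylor_coeff_zero]
  simp only [eval_prod, eval_pow, eval_sub, eval_X, eval_C]

theorem taylor_hermiteNewton_coeff_of_lt {a b : Fin (N * L)} (hba : b < a) :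
    (taylor (x b.divNat) (hermiteNewton L x a)).coeff b.modNat = 0 := by
  have hdiv : b.divNat ≤ a.divNat := Nat.div_le_div_right hba.le
  rw [hermiteNewton, taylor_mul, taylor_pow]
  rcases hdiv.lt_or_eq with h | h
  · have hdvd : X ^ L ∣ taylor (x b.divNat) (∏ i ∈ Iio a.divNat, (X - C (x i)) ^ L) := by
      rw [← mul_prod_erase _ _ (mem_Iio.2 h), taylor_mul, taylor_pow, taylor_X_sub_C_self]
      exact dvd_mul_right _ _
    exact X_pow_dvd_iff.1 (hdvd.mul_right _) _ b.modNat.2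
  · have hmod : (b.modNat : ℕ) < a.modNat := by
      have hquot : (b : ℕ) / L = a / L := congrArg Fin.val h
      have hb := Nat.div_add_mod' (b : ℕ) L
      have ha := Nat.div_add_mod' (a : ℕ) L
      rw [hquot] at hb
      simp only [Fin.coe_modNat]
      omega
    rw [h, taylor_X_sub_C_self, coeff_mul_X_pow', if_neg hmod.not_ge]

theorem prod_comp_divNat {M : Type*} [CommMonoid M] (g : Fin N → M) :
    ∏ a : Fin (N * L), g a.divNat = ∏ j, g j ^ L := by
  rw [← finProdFinEquiv.prod_comp, Fintype.prod_prod_type]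
  refine prod_congr rfl fun j _ => ?_
  have hdiv (l : Fin L) : (finProdFinEquiv (j, l)).divNat = j :=
    congrArg Prod.fst (finProdFinEquiv.symm_apply_apply (j, l))
  simp only [hdiv, prod_const, card_univ, Fintype.card_fin]

theorem det_confluentVandermonde_hermiteNewton :
    (confluentVandermonde x (hermiteNewton L x)).det = (Matrix.vandermonde x).det ^ (L ^ 2) := by
  have htriangular : (confluentVandermonde x (hermiteNewton L x)).IsUpperTriangular :=
    fun _ _ hba => taylor_hermiteNewton_coeff_of_lt x hba
  rw [Matrix.det_of_isUpperTriangular htriangular]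
  calc ∏ a, confluentVandermonde x (hermiteNewton L x) a a
      = ∏ a : Fin (N * L), ∏ i ∈ Iio a.divNat, (x a.divNat - x i) ^ L :=
        prod_congr rfl fun a _ => taylor_hermiteNewton_coeff_self x a
    _ = (∏ j, ∏ i ∈ Iio j, (x j - x i)) ^ (L ^ 2) := by
        rw [prod_comp_divNat fun j => ∏ i ∈ Iio j, (x j - x i) ^ L]
        simp only [prod_pow, ← pow_mul, ← sq]
    _ = (Matrix.vandermonde x).det ^ (L ^ 2) := by
        rw [Matrix.det_vandermonde,
          prod_comm' (s := univ) (t := Iio) (t' := univ) (s' := Ioi) (by simp)]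

theorem det_confluentVandermonde {p : Fin (N * L) → R[X]} (hdeg : ∀ a, (p a).natDegree = a)
    (hmonic : ∀ a, (p a).Monic) :
    (confluentVandermonde x p).det = (Matrix.vandermonde x).det ^ (L ^ 2) := by
  nontriviality R
  let f (b : Fin (N * L)) : R[X] →ₗ[R] R := lcoeff R b.modNat ∘ₗ taylor (x b.divNat)
  rw [← det_confluentVandermonde_hermiteNewton x]
  exact (det_linearMap_of_monic hdeg hmonic f).trans
    (det_linearMap_of_monic (natDegree_hermiteNewton x) (hermiteNewton_monic x) f).symm

end ConfluentVandermonde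

section Wronskian

open ExteriorAlgebra

theorem wronskian_eq_det_taylor {L : ℕ} (q : Fin L → ℂ[X]) (x : ℂ) :
    wronskian q x = (Matrix.of fun n l : Fin L => (Polynomial.taylor x (q n)).coeff l).det := by
  rw [wronskian]
  congr 2
  ext n l
  have hfactorial : ((l : ℕ)! : ℂ) ≠ 0 := Nat.cast_ne_zero.2 (Nat.factorial_ne_zero _)
  rw [Polynomial.taylor_coeff, ← Polynomial.factorial_smul_hasseDeriv, LinearMap.smul_apply,
    Polynomial.eval_smul, nsmul_eq_mul, one_div, inv_mul_cancel_left₀ hfactorial]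

theorem sum_wronskian_smul_wedgeBasis {n : ℕ} (L : ℕ) (p : Fin n → ℂ[X]) (x : ℂ) :
    ∑ t : Fin L ↪o Fin n, wronskian (fun l => p (t l)) x • wedgeBasis t =
      ιMulti ℂ L (fun l a => (Polynomial.taylor x (p a)).coeff l) := by
  rw [ιMulti_eq_sum_det_smul (Pi.basisFun ℂ (Fin n))]
  refine sum_congr rfl fun t _ => ?_
  rw [wronskian_eq_det_taylor, ← Matrix.det_transpose, wedgeBasis]
  congr 2
  funext l
  exact (Pi.basisFun_apply ℂ (Fin n) (t l)).symm

theorem volumeCoeff_prod_sum_wronskian {N L : ℕ} {p : Fin (N * L) → ℂ[X]} (hp : IsCompleteMonic p)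
    (x : Fin N → ℂ) :
    volumeCoeff (N * L) (List.ofFn fun j =>
        ∑ t : Fin L ↪o Fin (N * L), wronskian (fun l => p (t l)) (x j) • wedgeBasis t).prod =
      (Matrix.vandermonde x).det ^ (L ^ 2) := by
  simp only [sum_wronskian_smul_wedgeBasis]
  rw [prod_ofFn_ιMulti (fun (j : Fin N) (l : Fin L) a => (Polynomial.taylor (x j) (p a)).coeff l),
    volumeCoeff_ιMulti, Module.Basis.det_apply,
    ← det_confluentVandermonde x (fun a => (hp a).2) fun a => (hp a).1]
  rfl

end Wronskian

section DeBruijn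

variable {𝕜 X : Type*} [RCLike 𝕜]

theorem norm_pairProd_le {κ : X → X → 𝕜} {C : ℝ} (hC : ∀ x y, ‖κ x y‖ ≤ C) :
    ∀ (n : ℕ) (θ : Fin n → X), ‖pairProd κ (fun _ => 1) n θ‖ ≤ C ^ (n / 2)
  | 0, _ => norm_one.le
  | 1, _ => norm_one.le
  | n + 2, θ => by
    rw [pairProd, norm_mul, Nat.add_div_right n two_pos, pow_succ']
    exact mul_le_mul (hC _ _) (norm_pairProd_le hC n _) (norm_nonneg _)
      ((norm_nonneg _).trans (hC (θ 0) (θ 1)))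

variable [MeasurableSpace X]

theorem measurable_pairProd {κ : X → X → 𝕜} (hκ : Measurable (Function.uncurry κ)) :
    ∀ n : ℕ, Measurable (pairProd κ (fun _ => 1) n)
  | 0 => measurable_const
  | 1 => measurable_const
  | n + 2 => by
    have hpair : Measurable fun θ : Fin (n + 2) → X => κ (θ 0) (θ 1) :=
      hκ.comp (f := fun θ : Fin (n + 2) → X => (θ 0, θ 1))
        ((measurable_pi_apply 0).prodMk (measurable_pi_apply 1))
    exact hpair.mul ((measurable_pairProd hκ n).comp
      (measurable_pi_lambda _ fun i => measurable_pi_apply i.succ.succ))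

variable {μ : Measure X} [SigmaFinite μ]

theorem integral_fin_cons_cons {E : Type*} [NormedAddCommGroup E] [NormedSpace ℝ E] {n : ℕ}
    (f : (Fin (n + 2) → X) → E) :
    ∫ θ, f θ ∂(Measure.pi fun _ => μ) =
      ∫ z, f (Fin.cons z.1.1 (Fin.cons z.1.2 z.2 : Fin (n + 1) → X))
        ∂((μ.prod μ).prod (Measure.pi fun _ : Fin n => μ)) := by
  have hcons (m : ℕ) := (measurePreserving_piFinSuccAbove (fun _ : Fin (m + 1) => μ) 0).symm
  rw [← (hcons (n + 1)).integral_comp',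
    ← ((MeasurePreserving.id μ).prod (hcons n)).integral_comp
      (MeasurableEmbedding.id.prodMap (MeasurableEquiv.measurableEmbedding _)),
    ← (measurePreserving_prodAssoc μ μ (Measure.pi fun _ : Fin n => μ)).integral_comp
      MeasurableEquiv.prodAssoc.measurableEmbedding]
  simp only [MeasurableEquiv.piFinSuccAbove_symm_apply, Fin.insertNthEquiv_zero]
  rfl

theorem integral_prod_mul_pairProd {κ : X → X → 𝕜} (hκ : Measurable (Function.uncurry κ)) {C : ℝ}
    (hC : ∀ x y, ‖κ x y‖ ≤ C) :
    ∀ {n : ℕ} {f : Fin n → X → 𝕜}, (∀ i, Integrable (f i) μ) →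
      ∫ θ, (∏ i, f i (θ i)) * pairProd κ (fun _ => 1) n θ ∂(Measure.pi fun _ => μ) =
        pairProd (fun g h => ∫ ψ, ∫ θ, g θ * h ψ * κ θ ψ ∂μ ∂μ) (fun g => ∫ θ, g θ ∂μ) n f
  | 0, _, _ => by simp [pairProd, Measure.real]
  | 1, f, _ => by
    simp only [pairProd, mul_one]
    rw [integral_fintype_prod_eq_prod, Fin.prod_univ_one]
  | n + 2, f, hf => by
    have hpair : Integrable (fun z : X × X => f 0 z.1 * f 1 z.2 * κ z.1 z.2) (μ.prod μ) :=
      ((hf 0).mul_prod (hf 1)).mul_bdd hκ.aestronglyMeasurable (ae_of_all _ fun z => hC z.1 z.2)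
    rw [pairProd, ← integral_prod_mul_pairProd hκ hC fun i => hf i.succ.succ,
      ← integral_prod_symm _ hpair, ← integral_prod_mul, integral_fin_cons_cons]
    refine integral_congr_ae (ae_of_all _ fun z => ?_)
    simp only [pairProd, Fin.prod_univ_succ, Fin.cons_zero, Fin.cons_succ, Fin.cons_one,
      Fin.succ_zero_eq_one]
    ring

theorem integrable_prod_mul_pairProd {κ : X → X → 𝕜} (hκ : Measurable (Function.uncurry κ))
    {C : ℝ} (hC : ∀ x y, ‖κ x y‖ ≤ C) {n : ℕ} {f : Fin n → X → 𝕜} (hf : ∀ i, Integrable (f i) μ) :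
    Integrable (fun θ => (∏ i, f i (θ i)) * pairProd κ (fun _ => 1) n θ)
      (Measure.pi fun _ => μ) :=
  (Integrable.fintype_prod hf).mul_bdd (measurable_pairProd hκ n).aestronglyMeasurable
    (ae_of_all _ (norm_pairProd_le hC n))

theorem map_prod_ofFn_sum_smul {R A T : Type*} [CommSemiring R] [Semiring A] [Algebra R A]
    [Fintype T] {n : ℕ} (Φ : A →ₗ[R] R) (a : Fin n → T → R) (e : T → A) :
    Φ (List.ofFn fun i => ∑ t, a i t • e t).prod =
      ∑ τ : Fin n → T, (∏ i, a i (τ i)) * Φ (List.ofFn fun i => e (τ i)).prod := by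
  rw [← MultilinearMap.mkPiAlgebraFin_apply (R := R), MultilinearMap.map_sum, map_sum]
  simp only [MultilinearMap.map_smul_univ, MultilinearMap.mkPiAlgebraFin_apply, map_smul,
    smul_eq_mul]

theorem integral_comp_perm {E : Type*} [NormedAddCommGroup E] [NormedSpace ℝ E] {n : ℕ}
    (σ : Equiv.Perm (Fin n)) (f : (Fin n → X) → E) :
    ∫ θ, f (θ ∘ σ) ∂(Measure.pi fun _ => μ) = ∫ θ, f θ ∂(Measure.pi fun _ => μ) :=
  (measurePreserving_arrowCongr' (fun _ => μ) (fun _ => μ) σ.symm (MeasurableEquiv.refl X)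
    fun _ => MeasurePreserving.id μ).integral_comp' f

theorem factorial_mul_integral_mul_of_antisymm {n : ℕ} {F K : (Fin n → X) → 𝕜}
    (hFK : Integrable (fun θ => F θ * K θ) (Measure.pi fun _ => μ))
    (hF : ∀ (σ : Equiv.Perm (Fin n)) θ, F (θ ∘ σ) = ((Equiv.Perm.sign σ : ℤ) : 𝕜) * F θ) :
    (n ! : 𝕜) * ∫ θ, F θ * K θ ∂(Measure.pi fun _ => μ) =
      ∫ θ, F θ * ∑ σ : Equiv.Perm (Fin n), ((Equiv.Perm.sign σ : ℤ) : 𝕜) * K (θ ∘ σ)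
        ∂(Measure.pi fun _ => μ) := by
  have hterm (σ : Equiv.Perm (Fin n)) (θ : Fin n → X) :
      F θ * (((Equiv.Perm.sign σ : ℤ) : 𝕜) * K (θ ∘ σ)) = F (θ ∘ σ) * K (θ ∘ σ) := by
    rw [hF]
    ring
  have hint (σ : Equiv.Perm (Fin n)) :
      Integrable (fun θ => F (θ ∘ σ) * K (θ ∘ σ)) (Measure.pi fun _ => μ) :=
    (measurePreserving_arrowCongr' (fun _ => μ) (fun _ => μ) σ.symm (MeasurableEquiv.refl X)
      fun _ => MeasurePreserving.id μ).integrable_comp_of_integrable hFK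
  simp only [mul_sum, hterm]
  rw [integral_finsetSum _ fun σ _ => hint σ]
  simp only [integral_comp_perm _ fun θ => F θ * K θ, sum_const, card_univ, Fintype.card_perm,
    Fintype.card_fin, nsmul_eq_mul]

variable {A T : Type*} [Ring A] [Algebra 𝕜 A] [Fintype T] {f : T → X → 𝕜}

theorem map_sum_integral_smul_pow (hf : ∀ t, Integrable (f t) μ) (Φ : A →ₗ[𝕜] 𝕜) (e : T → A)
    (n : ℕ) :
    Φ ((∑ t, (∫ θ, f t θ ∂μ) • e t) ^ n) =
      ∫ θ, Φ (List.ofFn fun i : Fin n => ∑ t, f t (θ i) • e t).prod ∂(Measure.pi fun _ => μ) := by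
  rw [← List.prod_replicate, ← List.ofFn_const]
  simp only [map_prod_ofFn_sum_smul]
  rw [integral_finsetSum _ fun τ _ => (Integrable.fintype_prod fun i => hf (τ i)).mul_const _]
  simp only [integral_mul_const, integral_fintype_prod_eq_prod]

variable {κ : X → X → 𝕜} {C : ℝ}

theorem integrable_map_prod_mul_pairProd (hf : ∀ t, Integrable (f t) μ)
    (hκ : Measurable (Function.uncurry κ)) (hC : ∀ x y, ‖κ x y‖ ≤ C) (Φ : A →ₗ[𝕜] 𝕜) (e : T → A)
    (n : ℕ) :
    Integrable (fun θ => Φ (List.ofFn fun i : Fin n => ∑ t, f t (θ i) • e t).prod *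
      pairProd κ (fun _ => 1) n θ) (Measure.pi fun _ => μ) := by
  simp only [map_prod_ofFn_sum_smul, sum_mul, mul_right_comm]
  exact integrable_finsetSum _ fun τ _ =>
    (integrable_prod_mul_pairProd hκ hC fun i => hf (τ i)).mul_const _

theorem map_sum_integral_smul_pow_mul_pow (hf : ∀ t, Integrable (f t) μ)
    (hκ : Measurable (Function.uncurry κ)) (hC : ∀ x y, ‖κ x y‖ ≤ C) (Φ : A →ₗ[𝕜] 𝕜) (e : T → A)
    (n : ℕ) :
    Φ ((∑ t, ∑ u, (∫ ψ, ∫ θ, f t θ * f u ψ * κ θ ψ ∂μ ∂μ) • (e t * e u)) ^ (n / 2) *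
        (∑ t, (∫ θ, f t θ ∂μ) • e t) ^ (n % 2)) =
      ∫ θ, Φ (List.ofFn fun i : Fin n => ∑ t, f t (θ i) • e t).prod * pairProd κ (fun _ => 1) n θ
        ∂(Measure.pi fun _ => μ) := by
  rw [sum_smul_mul_pow_mul_sum_smul_pow, map_sum]
  simp only [map_prod_ofFn_sum_smul, sum_mul, mul_right_comm]
  rw [integral_finsetSum _ fun τ _ =>
    (integrable_prod_mul_pairProd hκ hC fun i => hf (τ i)).mul_const _]
  refine sum_congr rfl fun τ _ => ?_
  rw [integral_mul_const, integral_prod_mul_pairProd hκ hC fun i => hf (τ i), map_smul, smul_eq_mul,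
    pairProd_comp _ _ f]

theorem factorial_mul_map_sum_integral_smul_pow_mul_pow (hf : ∀ t, Integrable (f t) μ)
    (hκ : Measurable (Function.uncurry κ)) (hC : ∀ x y, ‖κ x y‖ ≤ C) (Φ : A →ₗ[𝕜] 𝕜) (e : T → A)
    {n : ℕ} (hanti : ∀ (σ : Equiv.Perm (Fin n)) (θ : Fin n → X),
      Φ (List.ofFn fun i => ∑ t, f t (θ (σ i)) • e t).prod =
        ((Equiv.Perm.sign σ : ℤ) : 𝕜) * Φ (List.ofFn fun i => ∑ t, f t (θ i) • e t).prod) :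
    (n ! : 𝕜) * Φ ((∑ t, ∑ u, (∫ ψ, ∫ θ, f t θ * f u ψ * κ θ ψ ∂μ ∂μ) • (e t * e u)) ^ (n / 2) *
        (∑ t, (∫ θ, f t θ ∂μ) • e t) ^ (n % 2)) =
      ∫ θ, Φ (List.ofFn fun i : Fin n => ∑ t, f t (θ i) • e t).prod *
        pfaffianSum (fun i j => κ (θ i) (θ j)) (fun _ => 1) ∂(Measure.pi fun _ => μ) := by
  rw [map_sum_integral_smul_pow_mul_pow hf hκ hC, factorial_mul_integral_mul_of_antisymm
    (integrable_map_prod_mul_pairProd hf hκ hC Φ e n) hanti]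
  refine integral_congr_ae (ae_of_all _ fun θ => ?_)
  simp only [pfaffianSum, ← pairProd_comp κ (fun _ => 1) θ]
  rfl

end DeBruijn

section CircularEnsemble

/-- The arc-length measure on `[-π,π)`, the reference measure of `circularIntegral`. -/
def circleMeasure : Measure ℝ := volume.restrict (Set.Ico (-Real.pi) Real.pi)

instance : IsFiniteMeasure circleMeasure :=
  ⟨by rw [circleMeasure, Measure.restrict_apply_univ, Real.volume_Ico]; exact ENNReal.ofReal_lt_top⟩

theorem pi_circleMeasure (N : ℕ) : Measure.pi (fun _ : Fin N => circleMeasure) =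
    volume.restrict (Set.univ.pi fun _ : Fin N => Set.Ico (-Real.pi) Real.pi) := by
  simp only [volume_pi, Measure.restrict_pi_pi, circleMeasure]

theorem integrable_circleMeasure_of_continuous {f : ℝ → ℂ} (hf : Continuous f) :
    Integrable f circleMeasure :=
  hf.integrableOn_Icc.mono_set Set.Ico_subset_Icc_self

/-- The integrand `∏_{m<n} |e^{iθ_n} - e^{iθ_m}|^β` of `circularPartition`. -/
def dysonWeight {N : ℕ} (β : ℕ) (θ : Fin N → ℝ) : ℝ :=
  ∏ m, ∏ n ∈ Ioi m,
    ‖Complex.exp (Complex.I * (θ n : ℂ)) - Complex.exp (Complex.I * (θ m : ℂ))‖ ^ β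

theorem factorial_mul_circularPartition (N β : ℕ) :
    (N ! : ℂ) * circularPartition N β =
      ∫ θ, (dysonWeight β θ : ℂ) ∂(Measure.pi fun _ : Fin N => circleMeasure) := by
  have hN : (N ! : ℂ) ≠ 0 := Nat.cast_ne_zero.2 N.factorial_ne_zero
  rw [integral_complex_ofReal, pi_circleMeasure, circularPartition]
  push_cast
  rw [← mul_assoc, mul_one_div_cancel hN, one_mul]
  rfl

/-- A square root of `-i e^{-iθ}`, continuous in `θ`. The density of the complex measure `μ` is an
integral power of it. -/
def halfPhase (θ : ℝ) : ℂ := Complex.exp (-Complex.I * ((θ : ℂ) + (Real.pi : ℂ) / 2) / 2)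

theorem circularDensity_succ (N β : ℕ) (θ : ℝ) :
    circularDensity (N + 1) β θ = halfPhase θ ^ (β * N) := by
  rw [circularDensity, halfPhase, ← Complex.exp_nat_mul]
  congr 1
  push_cast
  ring

theorem exp_sub_exp_mul_halfPhase (θ ψ : ℝ) :
    (Complex.exp (Complex.I * (ψ : ℂ)) - Complex.exp (Complex.I * (θ : ℂ))) *
      (halfPhase θ * halfPhase ψ) = ((2 * Real.sin ((ψ - θ) / 2) : ℝ) : ℂ) := by
  have hphase : halfPhase θ * halfPhase ψ =
      -Complex.I * Complex.exp (-Complex.I * ((θ : ℂ) + ψ) / 2) := by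
    have hexponent : -Complex.I * ((θ : ℂ) + (Real.pi : ℂ) / 2) / 2 +
        -Complex.I * ((ψ : ℂ) + (Real.pi : ℂ) / 2) / 2 =
        -((Real.pi : ℂ) / 2 * Complex.I) + -Complex.I * ((θ : ℂ) + ψ) / 2 := by ring
    rw [halfPhase, halfPhase, ← Complex.exp_add, hexponent, Complex.exp_add, Complex.exp_neg,
      Complex.exp_pi_div_two_mul_I, Complex.inv_I]
  have hψ : Complex.exp (Complex.I * (ψ : ℂ)) * Complex.exp (-Complex.I * ((θ : ℂ) + ψ) / 2) =
      Complex.exp (((ψ : ℂ) - θ) / 2 * Complex.I) := by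
    rw [← Complex.exp_add]; congr 1; ring
  have hθ : Complex.exp (Complex.I * (θ : ℂ)) * Complex.exp (-Complex.I * ((θ : ℂ) + ψ) / 2) =
      Complex.exp (-(((ψ : ℂ) - θ) / 2) * Complex.I) := by
    rw [← Complex.exp_add]; congr 1; ring
  rw [hphase]
  push_cast
  rw [Complex.sin, ← hψ, ← hθ]
  ring

theorem norm_exp_sub_exp (θ ψ : ℝ) :
    ‖Complex.exp (Complex.I * (ψ : ℂ)) - Complex.exp (Complex.I * (θ : ℂ))‖ =
      |2 * Real.sin ((ψ - θ) / 2)| := by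
  have hphase (x : ℝ) : ‖halfPhase x‖ = 1 := by
    rw [halfPhase, show -Complex.I * ((x : ℂ) + (Real.pi : ℂ) / 2) / 2 =
      ((-(x + Real.pi / 2) / 2 : ℝ) : ℂ) * Complex.I by push_cast; ring]
    exact Complex.norm_exp_ofReal_mul_I _
  rw [← Real.norm_eq_abs, ← Complex.norm_real, ← exp_sub_exp_mul_halfPhase, norm_mul, norm_mul,
    hphase, hphase, mul_one, mul_one]

theorem abs_two_mul_sin_half {x : ℝ} (hx : |x| < 2 * Real.pi) :
    |2 * Real.sin (x / 2)| = 2 * Real.sin (x / 2) * Real.sign x := by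
  obtain ⟨hlower, hupper⟩ := abs_lt.1 hx
  rcases lt_trichotomy x 0 with hneg | rfl | hpos
  · have := Real.sin_neg_of_neg_of_neg_pi_lt (x := x / 2) (by linarith) (by linarith)
    rw [Real.sign_of_neg hneg, abs_of_neg (by linarith), mul_neg_one]
  · simp
  · have := Real.sin_pos_of_pos_of_lt_pi (x := x / 2) (by linarith) (by linarith)
    rw [Real.sign_of_pos hpos, abs_of_pos (by linarith), mul_one]

theorem prod_prod_Ioi_mul {M : Type*} [CommMonoid M] {N : ℕ} (a : Fin N → M) :
    ∏ m, ∏ n ∈ Ioi m, a m * a n = ∏ j, a j ^ (N - 1) := by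
  rw [prod_prod_Ioi_mul_eq_prod_prod_off_diag fun _ i => a i]
  simp only [prod_const, card_compl, card_singleton, Fintype.card_fin]

/-- The Vandermonde determinant of the points `e^{iθ_j}`. -/
def circleVandermonde {N : ℕ} (θ : Fin N → ℝ) : ℂ :=
  (Matrix.vandermonde fun j => Complex.exp (Complex.I * (θ j : ℂ))).det

theorem circleVandermonde_comp_perm {N : ℕ} (σ : Equiv.Perm (Fin N)) (θ : Fin N → ℝ) :
    circleVandermonde (fun i => θ (σ i)) = ((Equiv.Perm.sign σ : ℤ) : ℂ) * circleVandermonde θ :=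
  Matrix.det_permute σ (Matrix.vandermonde fun j => Complex.exp (Complex.I * (θ j : ℂ)))

theorem circleVandermonde_pow_mul_prod_circularDensity {N : ℕ} (β : ℕ) (θ : Fin N → ℝ) :
    circleVandermonde θ ^ β * ∏ j, circularDensity N β (θ j) =
      ((∏ m, ∏ n ∈ Ioi m, (2 * Real.sin ((θ n - θ m) / 2)) ^ β : ℝ) : ℂ) := by
  cases N with
  | zero => simp [circleVandermonde]
  | succ N =>
    have hphase := prod_prod_Ioi_mul fun j => halfPhase (θ j)
    rw [Nat.add_sub_cancel] at hphase
    simp only [circularDensity_succ, mul_comm β, pow_mul, prod_pow]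
    rw [← prod_pow, ← hphase, circleVandermonde, Matrix.det_vandermonde, ← mul_pow,
      ← prod_mul_distrib]
    simp only [← prod_mul_distrib, exp_sub_exp_mul_halfPhase, Complex.ofReal_prod,
      Complex.ofReal_pow]

theorem dysonWeight_of_even {N β : ℕ} (hβ : Even β) (θ : Fin N → ℝ) :
    (dysonWeight β θ : ℂ) = circleVandermonde θ ^ β * ∏ j, circularDensity N β (θ j) := by
  simp only [circleVandermonde_pow_mul_prod_circularDensity, dysonWeight, norm_exp_sub_exp,
    hβ.pow_abs]

theorem dysonWeight_of_odd {N β : ℕ} (hβ : Odd β) {θ : Fin N → ℝ}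
    (hθ : ∀ j, θ j ∈ Set.Ico (-Real.pi) Real.pi) :
    (dysonWeight β θ : ℂ) = circleVandermonde θ ^ β * (∏ j, circularDensity N β (θ j)) *
      ∏ m, ∏ n ∈ Ioi m, signKernel (θ m) (θ n) := by
  have hdist (m n : Fin N) : |θ n - θ m| < 2 * Real.pi := by
    rw [abs_lt]
    constructor <;> linarith [(hθ m).1, (hθ m).2, (hθ n).1, (hθ n).2]
  have hsign (x : ℝ) : Real.sign x ^ β = Real.sign x := by
    rcases Real.sign_apply_eq x with h | h | h <;>
      simp only [h, hβ.neg_one_pow, zero_pow hβ.pos.ne', one_pow]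
  simp only [circleVandermonde_pow_mul_prod_circularDensity, dysonWeight, norm_exp_sub_exp,
    abs_two_mul_sin_half (hdist _ _), mul_pow _ (Real.sign _), hsign, prod_mul_distrib, signKernel,
    Complex.ofReal_mul, Complex.ofReal_prod]

theorem measurable_signKernel : Measurable (Function.uncurry signKernel) := by
  have hsign : Measurable Real.sign :=
    Measurable.ite measurableSet_Iio measurable_const
      (Measurable.ite measurableSet_Ioi measurable_const measurable_const)
  exact Complex.measurable_ofReal.comp (hsign.comp (measurable_snd.sub measurable_fst))

theorem norm_signKernel_le (θ ψ : ℝ) : ‖signKernel θ ψ‖ ≤ 1 := by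
  rw [signKernel, Complex.norm_real]
  rcases Real.sign_apply_eq (ψ - θ) with h | h | h <;> rw [h] <;> norm_num

theorem powerKernel_eq_sum (M : ℕ) (θ ψ : ℝ) :
    powerKernel M θ ψ = ∑ k ∈ range M,
      (Complex.exp (Complex.I * (θ : ℂ)) ^ (M - 1 - k) *
          Complex.exp (Complex.I * (ψ : ℂ)) ^ (M + k) -
        Complex.exp (Complex.I * (θ : ℂ)) ^ (M + k) *
          Complex.exp (Complex.I * (ψ : ℂ)) ^ (M - 1 - k)) := by
  have hpow (x : ℝ) : Complex.exp (Complex.I * (M : ℂ) * (x : ℂ)) =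
      Complex.exp (Complex.I * (x : ℂ)) ^ M := by
    rw [← Complex.exp_nat_mul]; congr 1; ring
  rw [powerKernel, hpow, hpow, ← sum_pow_mul_pow_sub_mul_sub]
  by_cases h : Complex.exp (Complex.I * (ψ : ℂ)) = Complex.exp (Complex.I * (θ : ℂ))
  · rw [h, sub_self, div_zero]
    exact (sum_eq_zero fun k _ => by ring).symm
  · rw [mul_div_cancel_right₀ _ (sub_ne_zero.2 h)]

theorem measurable_powerKernel (M : ℕ) : Measurable (Function.uncurry (powerKernel M)) := by
  unfold powerKernel Function.uncurry
  fun_prop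

theorem norm_powerKernel_le (M : ℕ) (θ ψ : ℝ) : ‖powerKernel M θ ψ‖ ≤ M * 2 := by
  have hpow (x : ℝ) (k : ℕ) : ‖Complex.exp (Complex.I * (x : ℂ)) ^ k‖ = 1 := by
    rw [norm_pow, mul_comm, Complex.norm_exp_ofReal_mul_I, one_pow]
  rw [powerKernel_eq_sum]
  refine (norm_sum_le_of_le _ fun k _ => (norm_sub_le _ _).trans_eq ?_).trans_eq
    (by rw [sum_const, card_range, nsmul_eq_mul])
  rw [norm_mul, norm_mul, hpow, hpow, hpow, hpow, one_mul, one_add_one_eq_two]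

end CircularEnsemble

section BorderedHyperpfaffian

open ExteriorAlgebra

theorem wedgeBasis_mem {n L : ℕ} (t : Fin L → Fin n) : wedgeBasis t ∈ ⋀[ℂ]^L (Fin n → ℂ) :=
  ιMulti_range ℂ L ⟨_, rfl⟩

theorem extendForm_volumeForm_mul_borderForm (N L : ℕ) :
    extendForm N L (volumeForm (N * L)) * borderForm N L = volumeForm ((N + 1) * L) := by
  rw [extendForm, volumeForm, wedgeBasis, map_apply_ιMulti, borderForm, wedgeBasis,
    ιMulti_mul_ιMulti, volumeForm, wedgeBasis, ← ιMulti_comp_cast (Nat.succ_mul N L).symm]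
  congr 1
  funext i
  refine Fin.addCases (fun i => ?_) (fun i => ?_) i
  · rw [Fin.append_left, Function.comp_apply, ← Pi.basisFun_apply, Module.Basis.constr_basis]
    rfl
  · rw [Fin.append_right]
    rfl

theorem volumeCoeff_extendForm_mul_borderForm {N L : ℕ} {x : ExteriorAlgebra ℂ (Fin (N * L) → ℂ)}
    (hx : x ∈ ⋀[ℂ]^(N * L) (Fin (N * L) → ℂ)) :
    volumeCoeff ((N + 1) * L) (extendForm N L x * borderForm N L) = volumeCoeff (N * L) x := by
  conv_lhs => rw [eq_volumeCoeff_smul x hx, map_smul, smul_mul_assoc,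
    extendForm_volumeForm_mul_borderForm, map_smul, volumeCoeff_volumeForm, smul_eq_mul, mul_one]

theorem extendForm_mul_borderForm_mul_self {N L : ℕ} (hL : 0 < L)
    {S : ExteriorAlgebra ℂ (Fin (N * L) → ℂ)} (hS : S ∈ ⋀[ℂ]^L (Fin (N * L) → ℂ)) :
    extendForm N L S * borderForm N L * (extendForm N L S * borderForm N L) = 0 := by
  have hborder : borderForm N L * borderForm N L = 0 := ιMulti_mul_self hL _
  have hcomm : borderForm N L * extendForm N L S =
      (-1 : ℂ) ^ (L * L) • (extendForm N L S * borderForm N L) :=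
    exteriorPower_mul_comm (wedgeBasis_mem _) (map_mem_exteriorPower _ hS)
  rw [mul_assoc, ← mul_assoc (borderForm N L), hcomm, smul_mul_assoc, mul_assoc, hborder, mul_zero,
    smul_zero, mul_zero]

theorem hyperpfaffian_extendForm_add_mul_borderForm {N L K : ℕ} (hL : 0 < L) (hN : N = 2 * K + 1)
    {A S : ExteriorAlgebra ℂ (Fin (N * L) → ℂ)} (hA : A ∈ ⋀[ℂ]^(L + L) (Fin (N * L) → ℂ))
    (hS : S ∈ ⋀[ℂ]^L (Fin (N * L) → ℂ)) :
    hyperpfaffian (K + 1) (extendForm N L A + extendForm N L S * borderForm N L) =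
      (1 / (K ! : ℂ)) * volumeCoeff (N * L) (A ^ K * S) := by
  have hcomm : Commute (extendForm N L A) (extendForm N L S * borderForm N L) :=
    commute_of_mem_exteriorPower_even (Even.add_self L) (map_mem_exteriorPower _ hA)
      (SetLike.mul_mem_graded (map_mem_exteriorPower _ hS) (wedgeBasis_mem _))
  have hpow : A ^ (K + 1) = 0 := by
    have hlt : Module.finrank ℂ (Fin (N * L) → ℂ) < (K + 1) • (L + L) := by
      rw [Module.finrank_fin_fun, smul_eq_mul, hN]
      linarith
    rw [← Submodule.mem_bot ℂ, ← exteriorPower_eq_bot_of_finrank_lt hlt]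
    exact SetLike.pow_mem_graded (K + 1) hA
  have htop : A ^ K * S ∈ ⋀[ℂ]^(N * L) (Fin (N * L) → ℂ) := by
    have hdeg : K • (L + L) + L = N * L := by rw [smul_eq_mul, hN]; ring
    have hmem := SetLike.mul_mem_graded (SetLike.pow_mem_graded K hA) hS
    rwa [hdeg] at hmem
  have hfactorial : (1 / ((K + 1)! : ℂ)) * (K + 1 : ℕ) = 1 / (K ! : ℂ) := by
    rw [Nat.factorial_succ, Nat.cast_mul]
    field_simp
  rw [hyperpfaffian, add_pow_of_commute_of_mul_self hcomm
    (extendForm_mul_borderForm_mul_self hL hS), ← map_pow, hpow, map_zero, zero_add, ← mul_assoc,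
    ← map_pow, ← map_mul, map_smul, map_nsmul, volumeCoeff_extendForm_mul_borderForm htop,
    smul_eq_mul, nsmul_eq_mul, ← mul_assoc, hfactorial]

end BorderedHyperpfaffian

section PartitionFunction

variable {N L : ℕ}

/-- The coefficient of `ω(e^{iθ}) dμ(θ) / dθ` at `ε_t`. -/
def weightedWronskian {n : ℕ} (N β : ℕ) (p : Fin n → ℂ[X]) (t : Fin L ↪o Fin n) (θ : ℝ) : ℂ :=
  wronskianAt p t θ * circularDensity N β θ

theorem integrable_weightedWronskian {n : ℕ} (N β : ℕ) (p : Fin n → ℂ[X]) (t : Fin L ↪o Fin n) :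
    Integrable (weightedWronskian N β p t) circleMeasure := by
  refine integrable_circleMeasure_of_continuous (Continuous.mul ?_ ?_)
  · unfold wronskianAt wronskian
    refine Continuous.matrix_det (continuous_matrix fun i j => ?_)
    exact continuous_const.mul ((Polynomial.continuous _).comp (by fun_prop))
  · unfold circularDensity
    fun_prop

theorem singleForm_eq (N L β : ℕ) (p : Fin (N * L) → ℂ[X]) :
    singleForm N L β p = ∑ t : Fin L ↪o Fin (N * L),
      (∫ θ, weightedWronskian N β p t θ ∂circleMeasure) • wedgeBasis t :=
  rfl

theorem doubleForm_eq (N L β : ℕ) (p : Fin (N * L) → ℂ[X]) (κ : ℝ → ℝ → ℂ) :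
    doubleForm N L β p κ = ∑ t : Fin L ↪o Fin (N * L), ∑ u : Fin L ↪o Fin (N * L),
      (∫ ψ, ∫ θ, weightedWronskian N β p t θ * weightedWronskian N β p u ψ * (1 / 2 * κ θ ψ)
        ∂circleMeasure ∂circleMeasure) • (wedgeBasis t * wedgeBasis u) := by
  refine sum_congr rfl fun t _ => sum_congr rfl fun u _ => ?_
  simp only [circularIntegral, ← integral_const_mul, ← integral_mul_const, weightedWronskian,
    circleMeasure]
  congr! 5
  ring

theorem singleForm_mem (N L β : ℕ) (p : Fin (N * L) → ℂ[X]) :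
    singleForm N L β p ∈ ⋀[ℂ]^L (Fin (N * L) → ℂ) :=
  Submodule.sum_mem _ fun t _ => Submodule.smul_mem _ _ (wedgeBasis_mem t)

theorem doubleForm_mem (N L β : ℕ) (p : Fin (N * L) → ℂ[X]) (κ : ℝ → ℝ → ℂ) :
    doubleForm N L β p κ ∈ ⋀[ℂ]^(L + L) (Fin (N * L) → ℂ) :=
  Submodule.sum_mem _ fun t _ => Submodule.sum_mem _ fun u _ => Submodule.smul_mem _ _
    (SetLike.mul_mem_graded (wedgeBasis_mem t) (wedgeBasis_mem u))

variable {p : Fin (N * L) → ℂ[X]}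

theorem volumeCoeff_prod_sum_weightedWronskian (hp : IsCompleteMonic p) (β : ℕ) (θ : Fin N → ℝ) :
    volumeCoeff (N * L) (List.ofFn fun j => ∑ t : Fin L ↪o Fin (N * L),
        weightedWronskian N β p t (θ j) • wedgeBasis t).prod =
      circleVandermonde θ ^ (L ^ 2) * ∏ j, circularDensity N β (θ j) := by
  have hscalar := (MultilinearMap.mkPiAlgebraFin ℂ N
    (ExteriorAlgebra ℂ (Fin (N * L) → ℂ))).map_smul_univ (fun j => circularDensity N β (θ j))
      fun j => ∑ t : Fin L ↪o Fin (N * L), wronskianAt p t (θ j) • wedgeBasis t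
  simp only [MultilinearMap.mkPiAlgebraFin_apply, smul_sum, smul_smul,
    mul_comm (circularDensity N β _)] at hscalar
  simp only [weightedWronskian]
  rw [hscalar, map_smul, smul_eq_mul, mul_comm, circleVandermonde,
    ← volumeCoeff_prod_sum_wronskian hp]
  rfl

theorem circleVandermonde_pow_mul_prod_comp_perm {k : ℕ} (hk : Odd k) (f : ℝ → ℂ)
    (σ : Equiv.Perm (Fin N)) (θ : Fin N → ℝ) :
    circleVandermonde (fun i => θ (σ i)) ^ k * ∏ j, f (θ (σ j)) =
      ((Equiv.Perm.sign σ : ℤ) : ℂ) * (circleVandermonde θ ^ k * ∏ j, f (θ j)) := by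
  have hsign : ((Equiv.Perm.sign σ : ℤ) : ℂ) ^ k = ((Equiv.Perm.sign σ : ℤ) : ℂ) := by
    rcases Int.units_eq_one_or (Equiv.Perm.sign σ) with h | h <;> simp [h, hk.neg_one_pow]
  rw [circleVandermonde_comp_perm, Equiv.prod_comp σ fun j => f (θ j), mul_pow, hsign, mul_assoc]

theorem volumeCoeff_doubleForm_pow_mul_singleForm_pow (hL : Odd (L ^ 2)) (hp : IsCompleteMonic p)
    {κ : ℝ → ℝ → ℂ} (hκ : Measurable (Function.uncurry κ)) {C : ℝ} (hC : ∀ θ ψ, ‖κ θ ψ‖ ≤ C)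
    {β : ℕ} (hβ : ∀ θ : Fin N → ℝ, (∀ j, θ j ∈ Set.Ico (-Real.pi) Real.pi) →
      circleVandermonde θ ^ (L ^ 2) * (∏ j, circularDensity N β (θ j)) *
          pfaffianSum (fun i j => (1 / 2 : ℂ) * κ (θ i) (θ j)) (fun _ => 1) =
        ((N / 2)! : ℂ) * dysonWeight β θ) :
    volumeCoeff (N * L) (doubleForm N L β p κ ^ (N / 2) * singleForm N L β p ^ (N % 2)) =
      ((N / 2)! : ℂ) * circularPartition N β := by
  have hnorm (θ ψ : ℝ) : ‖(1 / 2 : ℂ) * κ θ ψ‖ ≤ 1 / 2 * C := by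
    rw [norm_mul, norm_div, norm_one, Complex.norm_ofNat]
    exact mul_le_mul_of_nonneg_left (hC θ ψ) one_half_pos.le
  have hdeBruijn := factorial_mul_map_sum_integral_smul_pow_mul_pow
    (integrable_weightedWronskian N β p) (κ := fun θ ψ => 1 / 2 * κ θ ψ) (hκ.const_mul (1 / 2))
    hnorm (volumeCoeff (N * L)) (fun t : Fin L ↪o Fin (N * L) => wedgeBasis t) fun σ θ => by
      rw [volumeCoeff_prod_sum_weightedWronskian hp β fun i => θ (σ i),
        volumeCoeff_prod_sum_weightedWronskian hp β θ]
      exact circleVandermonde_pow_mul_prod_comp_perm hL _ σ θ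
  have hN : (N ! : ℂ) ≠ 0 := Nat.cast_ne_zero.2 N.factorial_ne_zero
  refine mul_left_cancel₀ hN ?_
  rw [doubleForm_eq, singleForm_eq, hdeBruijn, mul_left_comm, factorial_mul_circularPartition,
    ← integral_const_mul, pi_circleMeasure]
  simp only [volumeCoeff_prod_sum_weightedWronskian hp]
  exact setIntegral_congr_fun (MeasurableSet.univ_pi fun _ => measurableSet_Ico) fun θ hθ =>
    hβ θ fun j => hθ j (Set.mem_univ j)

theorem circularPartition_eq_hyperpfaffian_singleForm (hL : Even (L ^ 2))
    (hp : IsCompleteMonic p) :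
    (circularPartition N (L ^ 2) : ℂ) = hyperpfaffian N (singleForm N L (L ^ 2) p) := by
  have hN : (N ! : ℂ) ≠ 0 := Nat.cast_ne_zero.2 N.factorial_ne_zero
  rw [hyperpfaffian, map_smul, smul_eq_mul, one_div, eq_inv_mul_iff_mul_eq₀ hN,
    factorial_mul_circularPartition, singleForm_eq,
    map_sum_integral_smul_pow (integrable_weightedWronskian N (L ^ 2) p)]
  simp only [volumeCoeff_prod_sum_weightedWronskian hp, dysonWeight_of_even hL]

theorem volumeCoeff_doubleForm_signKernel_pow_mul_singleForm_pow (hL : Odd (L ^ 2))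
    (hp : IsCompleteMonic p) :
    volumeCoeff (N * L)
        (doubleForm N L (L ^ 2) p signKernel ^ (N / 2) * singleForm N L (L ^ 2) p ^ (N % 2)) =
      ((N / 2)! : ℂ) * circularPartition N (L ^ 2) :=
  volumeCoeff_doubleForm_pow_mul_singleForm_pow hL hp measurable_signKernel norm_signKernel_le
    fun θ hθ => by rw [pfaffianSum_signKernel, dysonWeight_of_odd hL hθ, mul_left_comm]

theorem volumeCoeff_doubleForm_powerKernel_pow {M : ℕ} {p : Fin (2 * M * L) → ℂ[X]}
    (hL : Odd (L ^ 2)) (hp : IsCompleteMonic p) :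
    volumeCoeff (2 * M * L) (doubleForm (2 * M) L (L ^ 2 + 1) p (powerKernel M) ^ M) =
      (M ! : ℂ) * circularPartition (2 * M) (L ^ 2 + 1) := by
  have h := volumeCoeff_doubleForm_pow_mul_singleForm_pow hL hp (measurable_powerKernel M)
    (norm_powerKernel_le M) (β := L ^ 2 + 1) fun θ _ => by
      simp only [powerKernel_eq_sum]
      rw [pfaffianSum_sum_pow_sub M fun j => Complex.exp (Complex.I * (θ j : ℂ)),
        ← circleVandermonde, dysonWeight_of_even hL.add_one, Nat.mul_div_cancel_left M two_pos]
      ring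
  rwa [Nat.mul_div_cancel_left M two_pos, Nat.mul_mod_right, pow_zero, mul_one] at h

theorem eq_hyperpfaffian_of_volumeCoeff_pow {n k : ℕ} {ω : ExteriorAlgebra ℂ (Fin n → ℂ)} {c : ℂ}
    (h : volumeCoeff n (ω ^ k) = (k ! : ℂ) * c) : c = hyperpfaffian k ω := by
  rw [hyperpfaffian, map_smul, h, smul_eq_mul, one_div,
    inv_mul_cancel_left₀ (Nat.cast_ne_zero.2 k.factorial_ne_zero)]

end PartitionFunction

end

theorem theorem2 (N L : ℕ) (hN : 0 < N) (hL : 0 < L)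
    (p : Fin (N * L) → Polynomial ℂ) (hp : IsCompleteMonic p) :
    (Even (L ^ 2) →
      (circularPartition N (L ^ 2) : ℂ) = hyperpfaffian N (singleForm N L (L ^ 2) p)) ∧
    (Odd (L ^ 2) → ∀ M : ℕ, N = 2 * M →
      (circularPartition N (L ^ 2) : ℂ) =
        hyperpfaffian M (doubleForm N L (L ^ 2) p signKernel)) ∧
    (Odd (L ^ 2) → ∀ K : ℕ, N + 1 = 2 * K →
      (circularPartition N (L ^ 2) : ℂ) =
        hyperpfaffian K
          (extendForm N L (doubleForm N L (L ^ 2) p signKernel) +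
            extendForm N L (singleForm N L (L ^ 2) p) * borderForm N L)) ∧
    (Even (L ^ 2 + 1) → ∀ M : ℕ, N = 2 * M →
      (circularPartition N (L ^ 2 + 1) : ℂ) =
        hyperpfaffian M (doubleForm N L (L ^ 2 + 1) p (powerKernel M))) := by
  refine ⟨fun h => circularPartition_eq_hyperpfaffian_singleForm h hp, ?_, ?_, ?_⟩
  · rintro h M rfl
    have hvol := volumeCoeff_doubleForm_signKernel_pow_mul_singleForm_pow h hp
    rw [Nat.mul_div_cancel_left M two_pos, Nat.mul_mod_right, pow_zero, mul_one] at hvol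
    exact eq_hyperpfaffian_of_volumeCoeff_pow hvol
  · intro h K hK
    obtain ⟨k, rfl⟩ : ∃ k, K = k + 1 := ⟨K - 1, by lia⟩
    have hvol := volumeCoeff_doubleForm_signKernel_pow_mul_singleForm_pow h hp
    rw [show N / 2 = k by lia, show N % 2 = 1 by lia, pow_one] at hvol
    rw [hyperpfaffian_extendForm_add_mul_borderForm hL (by lia) (doubleForm_mem _ _ _ _ _)
      (singleForm_mem _ _ _ _), hvol, one_div,
      inv_mul_cancel_left₀ (Nat.cast_ne_zero.2 k.factorial_ne_zero)]
  · rintro h M rfl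
    exact eq_hyperpfaffian_of_volumeCoeff_pow
      (volumeCoeff_doubleForm_powerKernel_pow (Nat.not_even_iff_odd.1 (Nat.even_add_one.1 h)) hp)
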